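/- **Theorem (Type III self-adjoint operator).** Let $m\in\mathbb{N}_0$ and $-1<\alpha<0$. For $n\in\mathbb{N}_0$ and $a\in\mathbb{R}$ let $$L_n^{a}(x)=\sum_{k=0}^{n}(-1)^k\binom{n+a}{n-k}\frac{x^k}{k!}$$ be the classical Laguerre polynomial, and put $\eta(x)=L_m^{-\alpha-1}(-x)$ (which is positive for $x\ge 0$), $$W_m^{\mathrm{III},\alpha}(x)=\frac{x^{\alpha}e^{-x}}{\eta(x)^2}\quad(x>0),$$ $$\ell_m^{\mathrm{III},\alpha}[y](x)=-xy''(x)+\Bigl(-1-\alpha+x+2x\,\frac{\eta'(x)}{\eta(x)}\Bigr)y'(x)+(-m+\alpha)\,y(x).$$ The Type III exceptional $X_m$-Laguerre polynomials are $L_{m,0}^{\mathrm{III},\alpha}=1$ and, for $n\ge m+1$, $$L_{m,n}^{\mathrm{III},\alpha}(x)=-x\,L_m^{-\alpha-1}(-x)\,\bigl(L_{n-m-1}^{\alpha+1}\bigr)'(x)+(m+1)\,L_{m+1}^{-\alpha-2}(-x)\,L_{n-m-1}^{\alpha+1}(x).$$ In the Hilbert space $H=L^2((0,\infty);W_m^{\mathrm{III},\alpha})$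 of complex-valued functions let the maximal domain be $$\Delta_m^{\mathrm{III},\alpha}=\{f:(0,\infty)\to\mathbb{C}\mid f,f'\in AC_{\mathrm{loc}}(0,\infty);\ f,\ \ell_m^{\mathrm{III},\alpha}[f]\in H\},$$ and for $f,g\in\Delta_m^{\mathrm{III},\alpha}$ put $$[f,g](x)=\frac{x^{\alpha+1}e^{-x}}{\eta(x)^2}\bigl(f(x)\overline{g'(x)}-f'(x)\overline{g(x)}\bigr).$$ The minimal operator $T_{0,m}^{\mathrm{III},\alpha}$ is $f\mapsto\ell_m^{\mathrm{III},\alpha}[f]$ on the set of those $f\in\Delta_m^{\mathrm{III},\alpha}$ for which $\lim_{x\to\infty}[f,g](x)-\lim_{x\to0^+}[f,g](x)=0$ for all $g\in\Delta_m^{\mathrm{III},\alpha}$. Define the operator $T_m^{\mathrm{III},\alpha}$ in $H$ by $$T_m^{\mathrm{III},\alpha}f=\ell_m^{\mathrm{III},\alpha}[f],\qquad \mathcal{D}(T_m^{\mathrm{III},\alpha})=\Bigl\{f\in\Delta_m^{\mathrm{III},\alpha}\;\Big|\;\lim_{x\to0^+}x^{\alpha+1}f'(x)=0\Bigr\}.$$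 Then $T_m^{\mathrm{III},\alpha}$ is a densely defined self-adjoint operator in $H$ that extends $T_{0,m}^{\mathrm{III},\alpha}$. For each $n\in\{0,m+1,m+2,\dots\}$ the polynomial $L_{m,n}^{\mathrm{III},\alpha}$ is an eigenfunction of $T_m^{\mathrm{III},\alpha}$ with eigenvalue $n-m+\alpha$, and these eigenfunctions are complete, i.e. their linear span is dense in $H$. The spectrum of $T_m^{\mathrm{III},\alpha}$ consists only of eigenvalues, and $$\sigma(T_m^{\mathrm{III},\alpha})=\{\,n-m+\alpha\mid n=0,m+1,m+2,m+3,\dots\}.$$ -/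

import Mathlib

open MeasureTheory Set Filter Topology Polynomial
open scoped ENNReal ComplexConjugate

noncomputable section

/-- The classical (generalized) Laguerre polynomial
`L_n^a(x) = ∑_{k=0}^n (-1)^k * binom(n+a, n-k) * x^k / k!`, for an arbitrary real parameter `a`,
where `binom(n+a, n-k) = (a+k+1)(a+k+2)⋯(a+n) / (n-k)!`. -/
def laguerrePoly (n : ℕ) (a : ℝ) : ℝ[X] :=
  ∑ k ∈ Finset.range (n + 1),
    C ((-1) ^ k * (∏ j ∈ Finset.Ioc k n, (a + (j : ℝ))) /
      (((n - k).factorial : ℝ) * (k.factorial : ℝ))) * X ^ k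

/-- The polynomial `x ↦ L_n^a(-x)`. -/
def laguerreNeg (n : ℕ) (a : ℝ) : ℝ[X] := (laguerrePoly n a).comp (-X)

/-- The first-order operator
`A_m^{III,α}[y](x) = x L_m^{-α}(-x) y'(x) - (m+1) L_{m+1}^{-α-1}(-x) y(x)`, on polynomials. -/
def opA (m : ℕ) (α : ℝ) (y : ℝ[X]) : ℝ[X] :=
  X * laguerreNeg m (-α) * derivative y - C ((m : ℝ) + 1) * laguerreNeg (m + 1) (-α - 1) * y

/-- The degrees `n = 0, m+1, m+2, …`. -/
def typeIIIIndex (m : ℕ) : Set ℕ := {n | n = 0 ∨ m + 1 ≤ n}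

/-- The Type III exceptional `X_m`-Laguerre polynomial `L_{m,n}^{III,α}`, for `n` in
`typeIIIIndex m`: it is `-A_m^{III,α+1}[L_{n-m-1}^{α+1}]` if `n ≥ m+1` and `1` if `n = 0`. -/
def typeIIIPoly (m : ℕ) (α : ℝ) (n : ℕ) : ℝ[X] :=
  if m + 1 ≤ n then -opA m (α + 1) (laguerrePoly (n - m - 1) (α + 1)) else 1

/-- The Type III polynomial as a complex-valued function of a real variable. -/
def typeIIIFun (m : ℕ) (α : ℝ) (n : ℕ) (x : ℝ) : ℂ := (((typeIIIPoly m α n).eval x : ℝ) : ℂ)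

/-- The denominator polynomial `η(x) = L_m^{-α-1}(-x)`. -/
def etaIII (m : ℕ) (α : ℝ) : ℝ[X] := laguerreNeg m (-α - 1)

/-- The weight `W_m^{III,α}(x) = x^α e^{-x} / (L_m^{-α-1}(-x))^2`. -/
def weightIII (m : ℕ) (α : ℝ) (x : ℝ) : ℝ :=
  x ^ α * Real.exp (-x) / ((etaIII m α).eval x) ^ 2

/-- The measure `W_m^{III,α}(x) dx` on `(0,∞)`. -/
def muIII (m : ℕ) (α : ℝ) : Measure ℝ :=
  (volume.restrict (Ioi 0)).withDensity (fun x => ENNReal.ofReal (weightIII m α x))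

/-- The Hilbert space `L²((0,∞); W_m^{III,α})`. -/
abbrev HIII (m : ℕ) (α : ℝ) : Type := Lp ℂ 2 (muIII m α)

/-- The Type III differential expression
`ℓ[y](x) = -x y'' + (-1 - α + x + 2 x η'(x)/η(x)) y' + (-m + α) y`, `η(x) = L_m^{-α-1}(-x)`. -/
def ellIII (m : ℕ) (α : ℝ) (y : ℝ → ℂ) (x : ℝ) : ℂ :=
  -(x : ℂ) * deriv (deriv y) x
    + ((-1 - α + x + 2 * x * ((derivative (etaIII m α)).eval x / (etaIII m α).eval x) : ℝ) : ℂ)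
        * deriv y x
    + ((-(m : ℝ) + α : ℝ) : ℂ) * y x

/-- Local absolute continuity on `(0,∞)`: absolute continuity on each compact subinterval. -/
def ACLocPos (f : ℝ → ℂ) : Prop :=
  ∀ a b : ℝ, 0 < a → a ≤ b → AbsolutelyContinuousOnInterval f a b

/-- The maximal domain `Δ_m^{III,α}`: functions `f` on `(0,∞)` (values of `f` outside `(0,∞)` are
irrelevant) with `f, f' ∈ AC_loc(0,∞)` and `f, ℓ[f] ∈ L²((0,∞); W_m^{III,α})`. -/
structure MaxDom (m : ℕ) (α : ℝ) (f : ℝ → ℂ) : Prop where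
  ac : ACLocPos f
  diff : ∀ x : ℝ, 0 < x → DifferentiableAt ℝ f x
  acDeriv : ACLocPos (deriv f)
  memLp : MemLp f 2 (muIII m α)
  memLpEll : MemLp (ellIII m α f) 2 (muIII m α)

/-- The sesquilinear form
`[f,g](x) = x^{α+1} e^{-x} / (L_m^{-α-1}(-x))^2 * (f(x) conj(g'(x)) - f'(x) conj(g(x)))`. -/
def bracketIII (m : ℕ) (α : ℝ) (f g : ℝ → ℂ) (x : ℝ) : ℂ :=
  ((x ^ (α + 1) * Real.exp (-x) / ((etaIII m α).eval x) ^ 2 : ℝ) : ℂ)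
    * (f x * conj (deriv g x) - deriv f x * conj (g x))

/-- `[f,g](x) |_{x=0}^{x=∞} = 0`: the limits of `[f,g]` at `0+` and at `∞` exist and agree. -/
def BracketVanishes (m : ℕ) (α : ℝ) (f g : ℝ → ℂ) : Prop :=
  ∃ c : ℂ, Tendsto (bracketIII m α f g) atTop (𝓝 c) ∧
    Tendsto (bracketIII m α f g) (𝓝[>] 0) (𝓝 c)

/-- The boundary condition `lim_{x → 0+} x^{α+1} f'(x) = 0`. -/
def BoundaryCond (α : ℝ) (f : ℝ → ℂ) : Prop :=
  Tendsto (fun x : ℝ => ((x ^ (α + 1) : ℝ) : ℂ) * deriv f x) (𝓝[>] 0) (𝓝 0)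

/-! ### Helper facts for the well-definedness of the operators -/

theorem etaIII_ne_zero (m : ℕ) (α : ℝ) : etaIII m α ≠ 0 := by
  intro h
  have h1 : laguerrePoly m (-α - 1) = 0 := by
    have h2 : (etaIII m α).comp (-X) = laguerrePoly m (-α - 1) := by
      unfold etaIII laguerreNeg
      simp [Polynomial.comp_assoc]
    rw [← h2, h]; simp
  have h3 : (laguerrePoly m (-α - 1)).coeff m ≠ 0 := by
    unfold laguerrePoly
    simp only [Polynomial.finsetSum_coeff, Polynomial.coeff_C_mul_X_pow]
    rw [Finset.sum_eq_single m]
    · simp [Nat.factorial_ne_zero]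
    · intro b _ hb
      simp [Ne.symm hb]
    · intro hm
      simp at hm
  exact h3 (by rw [h1]; simp)

theorem ae_muIII_iff (m : ℕ) (α : ℝ) {p : ℝ → Prop} :
    (∀ᵐ x ∂(muIII m α), p x) ↔ ∀ᵐ x ∂(volume.restrict (Ioi (0 : ℝ))), p x := by
  have hmeas : Measurable (fun x => ENNReal.ofReal (weightIII m α x)) := by
    unfold weightIII
    have := (etaIII m α).continuous.measurable
    fun_prop
  constructor
  · intro h
    have hfin : ({x | (etaIII m α).eval x = 0} : Set ℝ).Finite := by
      refine ((etaIII m α).roots.toFinset.finite_toSet).subset ?_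
      intro x hx
      simpa [etaIII_ne_zero] using hx
    have hne : ∀ᵐ x ∂(volume.restrict (Ioi (0 : ℝ))),
        ENNReal.ofReal (weightIII m α x) ≠ 0 := by
      have h0 : ∀ᵐ x ∂(volume.restrict (Ioi (0 : ℝ))), (etaIII m α).eval x ≠ 0 :=
        ae_restrict_of_ae (by
          rw [ae_iff]
          simpa using hfin.measure_zero volume)
      filter_upwards [h0, ae_restrict_mem measurableSet_Ioi] with x hx hx0
      have hx0' : (0 : ℝ) < x := hx0
      have : 0 < weightIII m α x := by unfold weightIII; positivity
      simpa using this
    exact (withDensity_absolutelyContinuous' hmeas.aemeasurable hne).ae_le h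
  · intro h
    exact (withDensity_absolutelyContinuous _ _).ae_le h

theorem acOn_congr {f g : ℝ → ℂ} {a b : ℝ} (hf : AbsolutelyContinuousOnInterval f a b)
    (h : ∀ x ∈ uIcc a b, g x = f x) : AbsolutelyContinuousOnInterval g a b := by
  rw [absolutelyContinuousOnInterval_iff] at hf ⊢
  intro ε hε
  obtain ⟨δ, hδ, H⟩ := hf ε hε
  refine ⟨δ, hδ, fun E hE hlt => ?_⟩
  refine lt_of_eq_of_lt (Finset.sum_congr rfl fun i hi => ?_) (H E hE hlt)
  have := hE.1 i hi
  rw [h _ this.1, h _ this.2]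

theorem ACLocPos.congr {f g : ℝ → ℂ} (hf : ACLocPos f) (h : ∀ x, 0 < x → g x = f x) :
    ACLocPos g := fun a b ha hab =>
  acOn_congr (hf a b ha hab) fun x hx => h x (by
    rw [uIcc_of_le hab] at hx; exact lt_of_lt_of_le ha hx.1)

theorem ACLocPos.ae_differentiableAt {f : ℝ → ℂ} (hf : ACLocPos f) :
    ∀ᵐ x ∂(volume.restrict (Ioi (0 : ℝ))), DifferentiableAt ℝ f x := by
  rw [ae_restrict_iff' measurableSet_Ioi]
  have H : ∀ n : ℕ, ∀ᵐ x : ℝ, x ∈ uIcc (1 / ((n : ℝ) + 1)) ((n : ℝ) + 1) →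
      DifferentiableAt ℝ f x := by
    intro n
    have hn : (1 : ℝ) ≤ (n : ℝ) + 1 := by
      have : (0 : ℝ) ≤ n := n.cast_nonneg
      linarith
    exact (hf _ _ (by positivity)
      (le_trans (div_le_one_of_le₀ hn (by positivity)) hn)).boundedVariationOn.ae_differentiableAt_of_mem_uIcc
  filter_upwards [ae_all_iff.2 H] with x hx hx0
  have hx0' : (0 : ℝ) < x := hx0
  obtain ⟨n, hn⟩ := exists_nat_ge (max x (1 / x))
  have h1 : x ≤ n := le_trans (le_max_left _ _) hn
  have h2 : 1 / x ≤ n := le_trans (le_max_right _ _) hn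
  refine hx n (mem_uIcc_of_le ?_ (by linarith))
  rw [div_le_iff₀ (by positivity)]
  rw [div_le_iff₀ hx0'] at h2
  nlinarith

theorem deriv_congr_pos {f g : ℝ → ℂ} (h : ∀ x, 0 < x → f x = g x) (x : ℝ) (hx : 0 < x) :
    deriv f x = deriv g x :=
  Filter.EventuallyEq.deriv_eq (by
    filter_upwards [Ioi_mem_nhds hx] with y hy using h y hy)

theorem ellIII_congr_pos (m : ℕ) (α : ℝ) {f g : ℝ → ℂ} (h : ∀ x, 0 < x → f x = g x)
    (x : ℝ) (hx : 0 < x) : ellIII m α f x = ellIII m α g x := by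
  unfold ellIII
  rw [h x hx, deriv_congr_pos h x hx, deriv_congr_pos (deriv_congr_pos h) x hx]

theorem deriv_add_pos {m : ℕ} {α : ℝ} {f g : ℝ → ℂ} (hf : MaxDom m α f) (hg : MaxDom m α g)
    (x : ℝ) (hx : 0 < x) : deriv (f + g) x = (deriv f + deriv g) x :=
  deriv_add (hf.diff x hx) (hg.diff x hx)

theorem deriv_smul_pos {m : ℕ} {α : ℝ} {f : ℝ → ℂ} (c : ℂ) (hf : MaxDom m α f)
    (x : ℝ) (hx : 0 < x) : deriv (c • f) x = (c • deriv f) x :=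
  deriv_const_smul c (hf.diff x hx)

theorem ellIII_add {m : ℕ} {α : ℝ} {f g : ℝ → ℂ} (hf : MaxDom m α f) (hg : MaxDom m α g) :
    ellIII m α (f + g) =ᵐ[muIII m α] ellIII m α f + ellIII m α g := by
  rw [EventuallyEq, ae_muIII_iff]
  filter_upwards [hf.acDeriv.ae_differentiableAt, hg.acDeriv.ae_differentiableAt,
    ae_restrict_mem measurableSet_Ioi] with x h1 h2 hx
  have e2 : deriv (deriv (f + g)) x = deriv (deriv f) x + deriv (deriv g) x := by
    rw [deriv_congr_pos (deriv_add_pos hf hg) x hx, deriv_add h1 h2]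
  simp only [ellIII, e2, deriv_add_pos hf hg x hx, Pi.add_apply]
  ring

theorem ellIII_smul {m : ℕ} {α : ℝ} {f : ℝ → ℂ} (c : ℂ) (hf : MaxDom m α f) :
    ellIII m α (c • f) =ᵐ[muIII m α] c • ellIII m α f := by
  rw [EventuallyEq, ae_muIII_iff]
  filter_upwards [hf.acDeriv.ae_differentiableAt, ae_restrict_mem measurableSet_Ioi] with x h1 hx
  have e2 : deriv (deriv (c • f)) x = c * deriv (deriv f) x := by
    rw [deriv_congr_pos (deriv_smul_pos c hf) x hx, deriv_const_smul c h1, smul_eq_mul]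
  simp only [ellIII, e2, deriv_smul_pos c hf x hx, Pi.smul_apply, smul_eq_mul]
  ring

theorem MaxDom.add {m : ℕ} {α : ℝ} {f g : ℝ → ℂ} (hf : MaxDom m α f) (hg : MaxDom m α g) :
    MaxDom m α (f + g) where
  ac := fun a b ha hab => (hf.ac a b ha hab).add (hg.ac a b ha hab)
  diff := fun x hx => (hf.diff x hx).add (hg.diff x hx)
  acDeriv := ACLocPos.congr (f := deriv f + deriv g)
    (fun a b ha hab => (hf.acDeriv a b ha hab).add (hg.acDeriv a b ha hab)) (deriv_add_pos hf hg)
  memLp := hf.memLp.add hg.memLp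
  memLpEll := (memLp_congr_ae (ellIII_add hf hg)).2 (hf.memLpEll.add hg.memLpEll)

theorem MaxDom.smul {m : ℕ} {α : ℝ} {f : ℝ → ℂ} (c : ℂ) (hf : MaxDom m α f) :
    MaxDom m α (c • f) where
  ac := fun a b ha hab => (hf.ac a b ha hab).const_smul c
  diff := fun x hx => (hf.diff x hx).const_smul c
  acDeriv := ACLocPos.congr (f := c • deriv f)
    (fun a b ha hab => (hf.acDeriv a b ha hab).const_smul c) (deriv_smul_pos c hf)
  memLp := hf.memLp.const_smul c
  memLpEll := (memLp_congr_ae (ellIII_smul c hf)).2 (hf.memLpEll.const_smul c)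

theorem MaxDom.zero (m : ℕ) (α : ℝ) : MaxDom m α (0 : ℝ → ℂ) := by
  have hac : ACLocPos (0 : ℝ → ℂ) := fun a b _ _ => by
    rw [absolutelyContinuousOnInterval_iff]
    exact fun ε hε => ⟨1, one_pos, fun E _ _ => by simpa using hε⟩
  have hd : deriv (0 : ℝ → ℂ) = 0 := by ext x; simp
  have he : ellIII m α (0 : ℝ → ℂ) = 0 := by ext x; simp [ellIII, hd]
  exact ⟨hac, fun x _ => differentiableAt_const (0 : ℂ), by rw [hd]; exact hac,
    MemLp.zero, by rw [he]; exact MemLp.zero⟩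

/-- Two functions of the maximal domain in the same `L²` class agree everywhere on `(0,∞)`. -/
theorem MaxDom.eq_pos {m : ℕ} {α : ℝ} {f g : ℝ → ℂ} (hf : MaxDom m α f) (hg : MaxDom m α g)
    (h : f =ᵐ[muIII m α] g) (x : ℝ) (hx : 0 < x) : f x = g x := by
  have h' : f =ᵐ[volume.restrict (Ioi (0 : ℝ))] g := (ae_muIII_iff m α).1 h
  exact Measure.eqOn_open_of_ae_eq h' isOpen_Ioi
    (fun y hy => (hf.diff y hy).continuousAt.continuousWithinAt)
    (fun y hy => (hg.diff y hy).continuousAt.continuousWithinAt) hx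

theorem MaxDom.ell_congr {m : ℕ} {α : ℝ} {f g : ℝ → ℂ} (hf : MaxDom m α f) (hg : MaxDom m α g)
    (h : f =ᵐ[muIII m α] g) : ellIII m α f =ᵐ[muIII m α] ellIII m α g := by
  rw [EventuallyEq, ae_muIII_iff]
  filter_upwards [ae_restrict_mem measurableSet_Ioi] with x hx
  exact ellIII_congr_pos m α (hf.eq_pos hg h) x hx

/-! ### The operators in `L²((0,∞); W_m^{III,α})` -/

/-- The `L²` classes of the functions of the maximal domain. -/
def maxDomain (m : ℕ) (α : ℝ) : Submodule ℂ (HIII m α) where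
  carrier := {u | ∃ f : ℝ → ℂ, MaxDom m α f ∧ u =ᵐ[muIII m α] f}
  zero_mem' := ⟨0, MaxDom.zero m α, Lp.coeFn_zero _ _ _⟩
  add_mem' := by
    rintro u v ⟨f, hf, hu⟩ ⟨g, hg, hv⟩
    exact ⟨f + g, hf.add hg, (Lp.coeFn_add u v).trans (hu.add hv)⟩
  smul_mem' := by
    rintro c u ⟨f, hf, hu⟩
    exact ⟨c • f, hf.smul c, (Lp.coeFn_smul c u).trans (hu.const_smul c)⟩

/-- The value `ℓ[f]` of the maximal operator at the class of `f`. -/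
def maxOpFun (m : ℕ) (α : ℝ) (u : maxDomain m α) : HIII m α :=
  (Classical.choose_spec u.2).1.memLpEll.toLp (ellIII m α (Classical.choose u.2))

theorem maxOpFun_ae {m : ℕ} {α : ℝ} (u : maxDomain m α) {f : ℝ → ℂ} (hf : MaxDom m α f)
    (hu : (u : HIII m α) =ᵐ[muIII m α] f) : maxOpFun m α u =ᵐ[muIII m α] ellIII m α f :=
  (MemLp.coeFn_toLp _).trans
    ((Classical.choose_spec u.2).1.ell_congr hf ((Classical.choose_spec u.2).2.symm.trans hu))

/-- The maximal operator `T_{1,m}^{III,α} f = ℓ[f]` on `Δ_m^{III,α}`. -/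
def maxOp (m : ℕ) (α : ℝ) : HIII m α →ₗ.[ℂ] HIII m α where
  domain := maxDomain m α
  toFun :=
    { toFun := maxOpFun m α
      map_add' := by
        intro u v
        obtain ⟨f, hf, hu⟩ := u.2
        obtain ⟨g, hg, hv⟩ := v.2
        refine Lp.ext ?_
        refine (maxOpFun_ae (u + v) (hf.add hg)
          ((Lp.coeFn_add (u : HIII m α) (v : HIII m α)).trans (hu.add hv))).trans ?_
        refine (ellIII_add hf hg).trans ?_
        exact ((Lp.coeFn_add _ _).trans ((maxOpFun_ae u hf hu).add (maxOpFun_ae v hg hv))).symm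
      map_smul' := by
        intro c u
        obtain ⟨f, hf, hu⟩ := u.2
        refine Lp.ext ?_
        refine (maxOpFun_ae (c • u) (hf.smul c)
          ((Lp.coeFn_smul c (u : HIII m α)).trans (hu.const_smul c))).trans ?_
        refine (ellIII_smul c hf).trans ?_
        exact ((Lp.coeFn_smul _ _).trans ((maxOpFun_ae u hf hu).const_smul c)).symm }

/-- `T_{1,m}^{III,α}` sends the class of `f ∈ Δ_m^{III,α}` to the class of `ℓ[f]`. -/
theorem maxOp_apply_ae {m : ℕ} {α : ℝ} (u : (maxOp m α).domain) {f : ℝ → ℂ} (hf : MaxDom m α f)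
    (hu : (u : HIII m α) =ᵐ[muIII m α] f) : maxOp m α u =ᵐ[muIII m α] ellIII m α f :=
  maxOpFun_ae u hf hu

/-- The domain of `T_{0,m}^{III,α}`: the `f ∈ Δ_m^{III,α}` such that `[f,g] |_0^∞ = 0` for all
`g ∈ Δ_m^{III,α}`. -/
def minDomain (m : ℕ) (α : ℝ) : Submodule ℂ (HIII m α) where
  carrier := {u | ∃ f : ℝ → ℂ, MaxDom m α f ∧ (∀ g : ℝ → ℂ, MaxDom m α g →
    BracketVanishes m α f g) ∧ u =ᵐ[muIII m α] f}
  zero_mem' := by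
    refine ⟨0, MaxDom.zero m α, fun g _ => ⟨0, ?_, ?_⟩, Lp.coeFn_zero _ _ _⟩ <;>
    · have : bracketIII m α 0 g = fun _ => 0 := by
        ext x
        have hd : deriv (0 : ℝ → ℂ) x = 0 := by simp
        simp [bracketIII, hd]
      rw [this]
      exact tendsto_const_nhds
  add_mem' := by
    rintro u v ⟨f, hf, hf', hu⟩ ⟨g, hg, hg', hv⟩
    refine ⟨f + g, hf.add hg, fun h hh => ?_, (Lp.coeFn_add u v).trans (hu.add hv)⟩
    obtain ⟨c, hc, hc'⟩ := hf' h hh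
    obtain ⟨d, hd, hd'⟩ := hg' h hh
    have e : ∀ x : ℝ, 0 < x →
        bracketIII m α f h x + bracketIII m α g h x = bracketIII m α (f + g) h x := by
      intro x hx
      simp only [bracketIII, deriv_add_pos hf hg x hx, Pi.add_apply]
      ring
    refine ⟨c + d, (hc.add hd).congr' ?_, (hc'.add hd').congr' ?_⟩
    · filter_upwards [eventually_gt_atTop 0] with x hx using e x hx
    · filter_upwards [self_mem_nhdsWithin] with x hx using e x hx
  smul_mem' := by
    rintro a u ⟨f, hf, hf', hu⟩
    refine ⟨a • f, hf.smul a, fun h hh => ?_, (Lp.coeFn_smul a u).trans (hu.const_smul a)⟩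
    obtain ⟨c, hc, hc'⟩ := hf' h hh
    have e : ∀ x : ℝ, 0 < x → a * bracketIII m α f h x = bracketIII m α (a • f) h x := by
      intro x hx
      simp only [bracketIII, deriv_smul_pos a hf x hx, Pi.smul_apply, smul_eq_mul]
      ring
    refine ⟨a * c, (hc.const_mul a).congr' ?_, (hc'.const_mul a).congr' ?_⟩
    · filter_upwards [eventually_gt_atTop 0] with x hx using e x hx
    · filter_upwards [self_mem_nhdsWithin] with x hx using e x hx

/-- The domain of `T_m^{III,α}`: the `f ∈ Δ_m^{III,α}` with `lim_{x → 0+} x^{α+1} f'(x) = 0`. -/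
def typeIIIDomain (m : ℕ) (α : ℝ) : Submodule ℂ (HIII m α) where
  carrier := {u | ∃ f : ℝ → ℂ, MaxDom m α f ∧ BoundaryCond α f ∧ u =ᵐ[muIII m α] f}
  zero_mem' := by
    refine ⟨0, MaxDom.zero m α, ?_, Lp.coeFn_zero _ _ _⟩
    have hd : deriv (0 : ℝ → ℂ) = 0 := by ext x; simp
    simp [BoundaryCond, hd]
  add_mem' := by
    rintro u v ⟨f, hf, hf', hu⟩ ⟨g, hg, hg', hv⟩
    refine ⟨f + g, hf.add hg, ?_, (Lp.coeFn_add u v).trans (hu.add hv)⟩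
    have := Tendsto.add hf' hg'
    rw [add_zero] at this
    refine this.congr' ?_
    filter_upwards [self_mem_nhdsWithin] with x hx
    rw [deriv_add_pos hf hg x hx, Pi.add_apply]
    ring
  smul_mem' := by
    rintro a u ⟨f, hf, hf', hu⟩
    refine ⟨a • f, hf.smul a, ?_, (Lp.coeFn_smul a u).trans (hu.const_smul a)⟩
    have := Tendsto.const_mul a hf'
    rw [mul_zero] at this
    refine this.congr' ?_
    filter_upwards [self_mem_nhdsWithin] with x hx
    rw [deriv_smul_pos a hf x hx, Pi.smul_apply, smul_eq_mul]
    ring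

/-- The minimal operator `T_{0,m}^{III,α}`: the restriction of the maximal operator to
`minDomain` (which is contained in `maxDomain`). -/
def minOp (m : ℕ) (α : ℝ) : HIII m α →ₗ.[ℂ] HIII m α := (maxOp m α).domRestrict (minDomain m α)

/-- The operator `T_m^{III,α} f = ℓ[f]`: the restriction of the maximal operator to
`typeIIIDomain` (which is contained in `maxDomain`). -/
def typeIIIOp (m : ℕ) (α : ℝ) : HIII m α →ₗ.[ℂ] HIII m α :=
  (maxOp m α).domRestrict (typeIIIDomain m α)

theorem minOp_domain (m : ℕ) (α : ℝ) : (minOp m α).domain = minDomain m α :=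
  inf_eq_left.2 fun _ ⟨f, hf, _, hu⟩ => ⟨f, hf, hu⟩

theorem typeIIIOp_domain (m : ℕ) (α : ℝ) : (typeIIIOp m α).domain = typeIIIDomain m α :=
  inf_eq_left.2 fun _ ⟨f, hf, _, hu⟩ => ⟨f, hf, hu⟩

/-! ### Spectra of unbounded operators -/

/-- The resolvent set of a partially defined operator `T`: the `z` for which
`T - z : D(T) → E` is a bijection with an everywhere defined bounded inverse `R`. -/
def pmapResolventSet {E : Type*} [NormedAddCommGroup E] [NormedSpace ℂ E] (T : E →ₗ.[ℂ] E) :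
    Set ℂ :=
  {z | ∃ R : E →L[ℂ] E, (∀ x : T.domain, R (T x - z • (x : E)) = x) ∧
    ∀ y : E, ∃ x : T.domain, (x : E) = R y ∧ T x - z • (x : E) = y}

/-- The spectrum: the complement of the resolvent set. -/
def pmapSpectrum {E : Type*} [NormedAddCommGroup E] [NormedSpace ℂ E] (T : E →ₗ.[ℂ] E) :
    Set ℂ := (pmapResolventSet T)ᶜ

/-- The point spectrum: the set of eigenvalues. -/
def pmapPointSpectrum {E : Type*} [NormedAddCommGroup E] [NormedSpace ℂ E] (T : E →ₗ.[ℂ] E) :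
    Set ℂ := {z | ∃ x : T.domain, (x : E) ≠ 0 ∧ T x = z • (x : E)}

end

/-! ### Laguerre polynomials -/

/-! With p = x W the expression has the divergence form W ℓ[f] = -(p f')' + (α - m) W f. The
operator is shown to be closed and to be diagonal in an orthonormal basis with real eigenvalues.
Self-adjointness then follows by passing to limits of finite sums of eigenvectors
(`isSelfAdjoint_of_eigenbasis`), and since the eigenvalues form a closed set, they are the whole
spectrum (`pmapSpectrum_of_eigenbasis`).

Eigenfunctions: the differential equation of η turns the derivative of the n-th polynomial, n ≥ m +
1, into n η L_{n-m-1}^{α+1} (`derivative_neg_opA_laguerrePoly`). This yields the eigenvalue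
equation. It also yields completeness: the Laguerre polynomials span all polynomials, so the Type
III polynomials span every polynomial whose derivative is divisible by η (`mem_span_typeIIIPoly`),
in particular all η² x^k. If u is orthogonal to them, all moments of η² u W vanish. As W decays
exponentially, the moments determine the function and u = 0 (`ae_eq_zero_of_complex_moments`).

Symmetry is needed only against polynomials q (`MaxDom.integral_mul_ellIII`). The boundary term p (f
q' - f' q) vanishes at infinity for every f of the maximal domain. At 0 the boundary condition says
p f' → 0, and because α < 0 it also forces f to have a finite limit, while p → 0.

Closedness: the boundary condition fixes the constant in p f' = -∫_0^x W (ℓ[f] - (α - m) f). Hence f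
is recovered from this right-hand side by two integrations, up to one additive constant, and these
integrals are stable under L² limits (`isClosed_typeIIIOp`). -/

theorem coeff_laguerrePoly_add (k d : ℕ) (a : ℝ) :
    (laguerrePoly (k + d) a).coeff k =
      (-1) ^ k * (∏ i ∈ Finset.range d, (a + k + 1 + i)) / ((d.factorial : ℝ) * k.factorial) := by
  unfold laguerrePoly
  simp only [Polynomial.finsetSum_coeff, Polynomial.coeff_C_mul_X_pow]
  rw [Finset.sum_eq_single k (fun b _ hb => by simp [hb.symm]) (fun h => by simp at h)]
  have hprod : ∏ j ∈ Finset.Ioc k (k + d), (a + (j : ℝ)) =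
      ∏ i ∈ Finset.range d, (a + k + 1 + i) := by
    induction d with
    | zero => simp
    | succ d ih =>
      rw [← add_assoc, Finset.prod_Ioc_succ_top (by omega), ih, Finset.prod_range_succ]
      push_cast
      ring
  simp [hprod]

theorem coeff_laguerrePoly_of_lt {n k : ℕ} (h : n < k) (a : ℝ) :
    (laguerrePoly n a).coeff k = 0 := by
  unfold laguerrePoly
  simp only [Polynomial.finsetSum_coeff, Polynomial.coeff_C_mul_X_pow]
  refine Finset.sum_eq_zero fun b hb => ?_
  rw [if_neg]
  have := Finset.mem_range.1 hb
  omega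

/-- This two-term recurrence is the Laguerre equation read coefficientwise. It holds for every k: at
k = n the factor k - n vanishes, and beyond that both coefficients do. -/
theorem coeff_laguerrePoly_succ (n k : ℕ) (a : ℝ) :
    (laguerrePoly n a).coeff (k + 1) * (k + 1) * (a + k + 1) =
      (k - n) * (laguerrePoly n a).coeff k := by
  rcases lt_trichotomy k n with h | rfl | h
  · obtain ⟨d, rfl⟩ := Nat.exists_eq_add_of_le (Nat.succ_le_of_lt h)
    rw [Nat.succ_eq_add_one, coeff_laguerrePoly_add, add_assoc k 1 d, coeff_laguerrePoly_add,
      add_comm 1 d, Finset.prod_range_succ']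
    have e : ∏ i ∈ Finset.range d, (a + ((k + 1 : ℕ) : ℝ) + 1 + i) =
        ∏ i ∈ Finset.range d, (a + k + 1 + ((i + 1 : ℕ) : ℝ)) :=
      Finset.prod_congr rfl fun i _ => by push_cast; ring
    rw [e, Nat.factorial_succ, Nat.factorial_succ]
    have h1 := Nat.cast_ne_zero (R := ℝ).2 d.factorial_ne_zero
    have h2 := Nat.cast_ne_zero (R := ℝ).2 k.factorial_ne_zero
    push_cast
    field_simp
    ring
  · rw [coeff_laguerrePoly_of_lt (Nat.lt_succ_self k)]
    ring
  · rw [coeff_laguerrePoly_of_lt h, coeff_laguerrePoly_of_lt (h.trans k.lt_succ_self)]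
    ring

/-- The Laguerre differential equation `x y'' + (a + 1 - x) y' + n y = 0`. -/
theorem laguerrePoly_ode (n : ℕ) (a : ℝ) :
    X * derivative (derivative (laguerrePoly n a)) +
      (C (a + 1) - X) * derivative (laguerrePoly n a) + C (n : ℝ) * laguerrePoly n a = 0 := by
  ext k
  simp only [sub_mul, coeff_add, coeff_sub, coeff_C_mul, coeff_zero]
  rcases k with _ | k
  · have := coeff_laguerrePoly_succ n 0 a
    simp [coeff_derivative] at this ⊢
    linarith
  · have := coeff_laguerrePoly_succ n (k + 1) a
    simp only [coeff_X_mul, coeff_derivative]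
    push_cast at this ⊢
    linear_combination this

/-- The relation `(n + 1) L_{n+1}^{a-1}(x) = (a - x) L_n^a(x) + x (L_n^a)'(x)`. -/
theorem laguerrePoly_succ_sub_one (n : ℕ) (a : ℝ) :
    C ((n : ℝ) + 1) * laguerrePoly (n + 1) (a - 1) =
      (C a - X) * laguerrePoly n a + X * derivative (laguerrePoly n a) := by
  ext k
  simp only [sub_mul, coeff_add, coeff_sub, coeff_C_mul]
  rcases k with _ | k
  · have h1 := coeff_laguerrePoly_add 0 n a
    have h2 := coeff_laguerrePoly_add 0 (n + 1) (a - 1)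
    rw [Finset.prod_range_succ', Nat.factorial_succ] at h2
    have e : ∏ i ∈ Finset.range n, (a - 1 + ((0 : ℕ) : ℝ) + 1 + ((i + 1 : ℕ) : ℝ)) =
        ∏ i ∈ Finset.range n, (a + ((0 : ℕ) : ℝ) + 1 + i) :=
      Finset.prod_congr rfl fun i _ => by push_cast; ring
    rw [e] at h2
    simp only [zero_add] at h1 h2
    have h3 := Nat.cast_ne_zero (R := ℝ).2 n.factorial_ne_zero
    rw [h1, h2]
    simp
    field_simp
  · simp only [coeff_X_mul, coeff_derivative]
    rcases lt_or_ge n k with h | h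
    · rw [coeff_laguerrePoly_of_lt h, coeff_laguerrePoly_of_lt (h.trans k.lt_succ_self),
        coeff_laguerrePoly_of_lt (Nat.succ_lt_succ h)]
      ring
    · obtain ⟨d, rfl⟩ := Nat.exists_eq_add_of_le h
      have h0 := coeff_laguerrePoly_succ (k + d) k a
      have h1 := coeff_laguerrePoly_add k d a
      have h2 := coeff_laguerrePoly_add (k + 1) d (a - 1)
      have e : ∏ i ∈ Finset.range d, (a - 1 + ((k + 1 : ℕ) : ℝ) + 1 + i) =
          ∏ i ∈ Finset.range d, (a + k + 1 + i) :=
        Finset.prod_congr rfl fun i _ => by push_cast; ring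
      have h3 := Nat.cast_ne_zero (R := ℝ).2 k.factorial_ne_zero
      have h4 := Nat.cast_ne_zero (R := ℝ).2 d.factorial_ne_zero
      have hk : ((k : ℝ) + 1) ≠ 0 := by positivity
      rw [e, Nat.factorial_succ] at h2
      -- The classical relation (L_{n+1}^{a-1})' = -L_n^a, coefficient by coefficient.
      have h5 : (laguerrePoly (k + 1 + d) (a - 1)).coeff (k + 1) * (k + 1) =
          - (laguerrePoly (k + d) a).coeff k := by
        rw [h1, h2]
        push_cast
        field_simp
        ring
      rw [show k + d + 1 = k + 1 + d by ring]
      refine mul_right_cancel₀ hk ?_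
      push_cast at h0 ⊢
      linear_combination ((k : ℝ) + d + 1) * h5 - h0

theorem degree_laguerrePoly (n : ℕ) (a : ℝ) : (laguerrePoly n a).degree = n := by
  refine degree_eq_of_le_of_coeff_ne_zero ?_ ?_
  · refine (degree_le_iff_coeff_zero _ _).2 fun k hk => coeff_laguerrePoly_of_lt ?_ a
    exact_mod_cast hk
  · have := coeff_laguerrePoly_add n 0 a
    rw [add_zero] at this
    rw [this]
    simp [Nat.factorial_ne_zero]

/-- There is one polynomial of each exact degree; this needs no orthogonality and hence no
restriction on a. -/
theorem span_laguerrePoly (a : ℝ) :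
    Submodule.span ℝ (Set.range fun n => laguerrePoly n a) = ⊤ := by
  let S : Polynomial.Sequence ℝ := ⟨fun n => laguerrePoly n a, fun n => degree_laguerrePoly n a⟩
  exact S.span fun i => by simp

/-! ### The polynomial `η` and the operator `opA` -/

theorem derivative_laguerreNeg (n : ℕ) (a : ℝ) :
    derivative (laguerreNeg n a) = -(derivative (laguerrePoly n a)).comp (-X) := by
  simp [laguerreNeg, derivative_comp]

/-- The Laguerre equation with parameter -α - 1 after the substitution x ↦ -x, which flips the sign
of the first derivative. -/
theorem etaIII_ode (m : ℕ) (α : ℝ) :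
    X * derivative (derivative (etaIII m α)) =
      (C α - X) * derivative (etaIII m α) + C (m : ℝ) * etaIII m α := by
  have h := congrArg (fun q : ℝ[X] => q.comp (-X)) (laguerrePoly_ode m (-α - 1))
  simp only [add_comp, mul_comp, sub_comp, X_comp, C_comp, zero_comp] at h
  have h1 : derivative (etaIII m α) = -(derivative (laguerrePoly m (-α - 1))).comp (-X) :=
    derivative_laguerreNeg _ _
  have h2 : derivative (derivative (etaIII m α)) =
      (derivative (derivative (laguerrePoly m (-α - 1)))).comp (-X) := by
    rw [h1]
    simp [derivative_comp]
  have h3 : etaIII m α = (laguerrePoly m (-α - 1)).comp (-X) := rfl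
  rw [h2, h1, h3]
  have hc : (C (-α - 1 + 1) : ℝ[X]) = -C α := by simp
  rw [hc] at h
  linear_combination -h

theorem laguerreNeg_succ_eq (m : ℕ) (α : ℝ) :
    C ((m : ℝ) + 1) * laguerreNeg (m + 1) (-α - 2) =
      (X - C (α + 1)) * etaIII m α + X * derivative (etaIII m α) := by
  have h := congrArg (fun q : ℝ[X] => q.comp (-X)) (laguerrePoly_succ_sub_one m (-α - 1))
  simp only [add_comp, mul_comp, sub_comp, X_comp, C_comp] at h
  have h1 : derivative (etaIII m α) = -(derivative (laguerrePoly m (-α - 1))).comp (-X) :=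
    derivative_laguerreNeg _ _
  have h3 : etaIII m α = (laguerrePoly m (-α - 1)).comp (-X) := rfl
  have h4 : laguerreNeg (m + 1) (-α - 2) = (laguerrePoly (m + 1) (-α - 1 - 1)).comp (-X) := by
    unfold laguerreNeg
    congr 2
    ring
  have hc : (C (α + 1) : ℝ[X]) = -C (-α - 1) := by
    rw [← C_neg]
    congr 1
    ring
  rw [h1, h3, h4, hc, h]
  ring

theorem neg_opA_eq (m : ℕ) (α : ℝ) (q : ℝ[X]) :
    -opA m (α + 1) q = -(X * etaIII m α * derivative q) +
      ((X - C (α + 1)) * etaIII m α + X * derivative (etaIII m α)) * q := by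
  have h1 : -(α + 1) = -α - 1 := by ring
  have h2 : -α - 1 - 1 = -α - 2 := by ring
  rw [opA, h1, h2, laguerreNeg_succ_eq]
  simp only [etaIII]
  ring

/-- The terms x η' q' cancel, and the coefficient of q, namely x η'' + (x - α) η' + η, collapses to
(m + 1) η by the equation for η. So η factors out of the derivative. -/
theorem derivative_neg_opA (m : ℕ) (α : ℝ) (q : ℝ[X]) :
    derivative (-opA m (α + 1) q) = etaIII m α *
      (-(X * derivative (derivative q)) - (C (α + 2) - X) * derivative q
        + C ((m : ℝ) + 1) * q) := by
  rw [neg_opA_eq]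
  simp only [derivative_add, derivative_neg, derivative_mul, derivative_sub, derivative_X,
    derivative_C]
  have h := etaIII_ode m α
  simp only [C_add, C_1, C_ofNat]
  rw [show (2 : ℝ[X]) = 1 + 1 by norm_num]
  linear_combination q * h

/-- The second factor in `derivative_neg_opA` is the Laguerre operator of parameter α + 1 shifted by
m + 1, so L_k^{α+1} is multiplied by k + m + 1. -/
theorem derivative_neg_opA_laguerrePoly (m : ℕ) (α : ℝ) (k : ℕ) :
    derivative (-opA m (α + 1) (laguerrePoly k (α + 1))) =
      C ((k : ℝ) + m + 1) * (etaIII m α * laguerrePoly k (α + 1)) := by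
  rw [derivative_neg_opA]
  have h := laguerrePoly_ode k (α + 1)
  have hc : (C (α + 2) : ℝ[X]) = C (α + 1 + 1) := by congr 1; ring
  rw [hc]
  simp only [C_add, C_1, map_natCast] at h ⊢
  linear_combination -(etaIII m α) * h

theorem typeIIIPoly_zero (m : ℕ) (α : ℝ) : typeIIIPoly m α 0 = 1 := by
  simp [typeIIIPoly]

theorem typeIIIPoly_add (m : ℕ) (α : ℝ) (k : ℕ) :
    typeIIIPoly m α (k + m + 1) = -opA m (α + 1) (laguerrePoly k (α + 1)) := by
  rw [typeIIIPoly, if_pos (by omega), show k + m + 1 - m - 1 = k by omega]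

/-- The eigenvalue equation of the Type III polynomials, multiplied by `η`. -/
theorem typeIIIPoly_eigen (m : ℕ) (α : ℝ) {n : ℕ} (hn : n ∈ typeIIIIndex m) :
    -(X * etaIII m α * derivative (derivative (typeIIIPoly m α n))) +
      ((X - C (α + 1)) * etaIII m α + C 2 * X * derivative (etaIII m α)) *
        derivative (typeIIIPoly m α n) = C (n : ℝ) * etaIII m α * typeIIIPoly m α n := by
  rcases hn with rfl | hn
  · simp [typeIIIPoly_zero]
  · obtain ⟨k, rfl⟩ : ∃ k, n = k + m + 1 := ⟨n - m - 1, by omega⟩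
    have h1 : derivative (typeIIIPoly m α (k + m + 1)) =
        C ((k : ℝ) + m + 1) * (etaIII m α * laguerrePoly k (α + 1)) := by
      rw [typeIIIPoly_add, derivative_neg_opA_laguerrePoly]
    have h2 := neg_opA_eq m α (laguerrePoly k (α + 1))
    rw [← typeIIIPoly_add] at h2
    rw [h1, h2]
    -- Given P' = n η L and the first-order formula for P, the equation is an identity in η, L and
    -- their first derivatives; no second-order equation is used again.
    simp only [derivative_mul, derivative_C]
    push_cast
    simp only [C_add, C_1, C_ofNat, map_natCast]
    ring

/-- Every polynomial whose derivative is divisible by `η` is a combination of Type III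
polynomials. -/
theorem mem_span_typeIIIPoly (m : ℕ) (α : ℝ) {r : ℝ[X]} (hr : etaIII m α ∣ derivative r) :
    r ∈ Submodule.span ℝ (Set.range fun n : typeIIIIndex m => typeIIIPoly m α n) := by
  set V := Submodule.span ℝ (Set.range fun n : typeIIIIndex m => typeIIIPoly m α n) with hV
  have hmem : ∀ n ∈ typeIIIIndex m, typeIIIPoly m α n ∈ V := fun n hn =>
    Submodule.subset_span ⟨⟨n, hn⟩, rfl⟩
  -- Derivatives of the nonconstant Type III polynomials are nonzero multiples of η L_k^{α+1}, so
  -- they reach every multiple of η. The remaining integration constant is a multiple of the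
  -- polynomial of index 0.
  have key : ∀ w : ℝ[X], ∃ v ∈ V, derivative v = etaIII m α * w := by
    intro w
    have hw : w ∈ Submodule.span ℝ (Set.range fun n => laguerrePoly n (α + 1)) := by
      rw [span_laguerrePoly]
      trivial
    induction hw using Submodule.span_induction with
    | mem w hw =>
      obtain ⟨k, rfl⟩ := hw
      refine ⟨((k : ℝ) + m + 1)⁻¹ • typeIIIPoly m α (k + m + 1),
        V.smul_mem _ (hmem _ (Or.inr (by omega))), ?_⟩
      have hk : ((k : ℝ) + m + 1) ≠ 0 := by positivity
      rw [derivative_smul, typeIIIPoly_add, derivative_neg_opA_laguerrePoly, smul_eq_C_mul,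
        ← mul_assoc, ← C_mul, inv_mul_cancel₀ hk, C_1, one_mul]
    | zero => exact ⟨0, V.zero_mem, by simp⟩
    | add x y _ _ hx hy =>
      obtain ⟨v, hv, hv'⟩ := hx
      obtain ⟨u, hu, hu'⟩ := hy
      exact ⟨v + u, V.add_mem hv hu, by rw [derivative_add, hv', hu']; ring⟩
    | smul c x _ hx =>
      obtain ⟨v, hv, hv'⟩ := hx
      exact ⟨c • v, V.smul_mem c hv, by rw [derivative_smul, hv', mul_smul_comm]⟩
  obtain ⟨w, hw⟩ := hr
  obtain ⟨v, hv, hv'⟩ := key w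
  have h0 : derivative (r - v) = 0 := by rw [derivative_sub, hw, hv', sub_self]
  have h1 := eq_C_of_derivative_eq_zero h0
  have h2 : r = v + (r - v).coeff 0 • typeIIIPoly m α 0 := by
    rw [typeIIIPoly_zero, smul_eq_C_mul, mul_one, ← h1]
    ring
  rw [h2]
  exact V.add_mem hv (V.smul_mem _ (hmem 0 (Or.inl rfl)))

/-! ### Positivity of η on [0,∞). -/

theorem etaIII_coeff (m : ℕ) (α : ℝ) (k : ℕ) :
    (etaIII m α).coeff k = (-1) ^ k * (laguerrePoly m (-α - 1)).coeff k := by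
  have h : (-X : ℝ[X]) = C (-1) * X := by simp
  rw [etaIII, laguerreNeg, h, comp_C_mul_X_coeff, mul_comm]

/-- The signs (-1)^k cancel, and the remaining factors -α + k + i are positive because α < 0. -/
theorem etaIII_coeff_nonneg (m : ℕ) {α : ℝ} (hα0 : α < 0) (k : ℕ) : 0 ≤ (etaIII m α).coeff k := by
  rw [etaIII_coeff]
  rcases lt_or_ge m k with hk | hk
  · rw [coeff_laguerrePoly_of_lt hk, mul_zero]
  · obtain ⟨d, rfl⟩ := Nat.exists_eq_add_of_le hk
    rw [coeff_laguerrePoly_add, mul_div_assoc, ← mul_assoc, ← mul_pow]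
    have : 0 ≤ ∏ i ∈ Finset.range d, (-α - 1 + (k : ℝ) + 1 + i) :=
      Finset.prod_nonneg fun i _ => by
        have h1 : (0 : ℝ) ≤ k := k.cast_nonneg
        have h2 : (0 : ℝ) ≤ i := i.cast_nonneg
        linarith
    norm_num
    positivity

theorem etaIII_coeff_zero_pos (m : ℕ) {α : ℝ} (hα0 : α < 0) : 0 < (etaIII m α).coeff 0 := by
  have h1 := coeff_laguerrePoly_add 0 m (-α - 1)
  rw [zero_add] at h1
  rw [etaIII_coeff, h1]
  have : 0 < ∏ i ∈ Finset.range m, (-α - 1 + ((0 : ℕ) : ℝ) + 1 + i) :=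
    Finset.prod_pos fun i _ => by
      have h2 : (0 : ℝ) ≤ i := i.cast_nonneg
      simp
      linarith
  simp only [pow_zero, one_mul]
  positivity

/-- A lower bound uniform in x; it makes 1/η bounded on the half-line. -/
theorem etaIII_coeff_zero_le_eval (m : ℕ) {α : ℝ} (hα0 : α < 0) {x : ℝ} (hx : 0 ≤ x) :
    (etaIII m α).coeff 0 ≤ (etaIII m α).eval x := by
  rw [eval_eq_sum_range, Finset.sum_range_succ']
  simp only [pow_zero, mul_one, le_add_iff_nonneg_left]
  exact Finset.sum_nonneg fun k _ => mul_nonneg (etaIII_coeff_nonneg m hα0 _) (pow_nonneg hx _)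

theorem etaIII_eval_pos (m : ℕ) {α : ℝ} (hα0 : α < 0) {x : ℝ} (hx : 0 ≤ x) :
    0 < (etaIII m α).eval x :=
  (etaIII_coeff_zero_pos m hα0).trans_le (etaIII_coeff_zero_le_eval m hα0 hx)

/-! ### Determinacy of measures with exponential moments -/

section Moments

open ProbabilityTheory

/-- The moments over n! are the Taylor coefficients at 0 of the complex moment generating function,
which is analytic on a vertical strip. The identity theorem carries equality near 0 to the imaginary
axis, where the function is the characteristic function. -/
theorem measure_ext_of_moments {μ ν : Measure ℝ} [IsFiniteMeasure μ] [IsFiniteMeasure ν]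
    (hμ : 0 ∈ interior (integrableExpSet id μ)) (hν : 0 ∈ interior (integrableExpSet id ν))
    (h : ∀ n : ℕ, ∫ x, x ^ n ∂μ = ∫ x, x ^ n ∂ν) : μ = ν := by
  have key : ∀ ρ : Measure ℝ, 0 ∈ interior (integrableExpSet id ρ) →
      HasFPowerSeriesAt (complexMGF id ρ) (FormalMultilinearSeries.ofScalars ℂ
        (fun n => (((∫ x, x ^ n ∂ρ : ℝ) : ℂ)) / n.factorial)) 0 := by
    intro ρ hρ
    have h0 : (0 : ℂ).re ∈ interior (integrableExpSet id ρ) := by simpa using hρ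
    convert! (analyticAt_complexMGF h0).hasFPowerSeriesAt using 4 with n
    rw [iteratedDeriv_complexMGF h0]
    refine integral_complex_ofReal.symm.trans ?_
    simp
  have h1 := key μ hμ
  have h2 := key ν hν
  simp only [h] at h1
  obtain ⟨r, hr⟩ := h1
  obtain ⟨r', hr'⟩ := h2
  have hpos : 0 < min r r' := lt_min hr.r_pos hr'.r_pos
  have h3 : complexMGF id μ =ᶠ[𝓝 0] complexMGF id ν := by
    filter_upwards [Metric.eball_mem_nhds (0 : ℂ) hpos] with z hz
    exact (hr.mono hpos (min_le_left _ _)).unique (hr'.mono hpos (min_le_right _ _)) hz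
  set S : Set ℝ := interior (integrableExpSet id μ) ∩ interior (integrableExpSet id ν)
  have hS : Convex ℝ S :=
    convex_integrableExpSet.interior.inter convex_integrableExpSet.interior
  have h4 : Set.EqOn (complexMGF id μ) (complexMGF id ν) {z | z.re ∈ S} := by
    refine AnalyticOnNhd.eqOn_of_preconnected_of_eventuallyEq
      (fun z hz => analyticAt_complexMGF hz.1) (fun z hz => analyticAt_complexMGF hz.2)
      (hS.linear_preimage Complex.reLm).isPreconnected (z₀ := 0) ?_ h3
    exact ⟨by simpa using hμ, by simpa using hν⟩
  refine Measure.ext_of_charFun (funext fun t => ?_)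
  rw [← complexMGF_id_mul_I, ← complexMGF_id_mul_I]
  refine h4 ?_
  show ((t : ℂ) * Complex.I).re ∈ S
  simp only [Complex.mul_re, Complex.ofReal_re, Complex.I_re, mul_zero, Complex.ofReal_im,
    Complex.I_im, zero_mul, sub_zero]
  exact ⟨hμ, hν⟩

/-- Vanishing moments say that the measures h⁺ μ and h⁻ μ have equal moments; both have exponential
moments of order below δ, so they coincide. -/
theorem ae_eq_zero_of_moments {μ : Measure ℝ} {h : ℝ → ℝ} (hm : AEStronglyMeasurable h μ) {δ : ℝ}
    (hδ : 0 < δ) (hi : Integrable (fun x => h x * Real.exp (δ * |x|)) μ)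
    (h0 : ∀ n : ℕ, ∫ x, h x * x ^ n ∂μ = 0) : h =ᵐ[μ] 0 := by
  have hint : Integrable h μ := by
    refine hi.mono hm (Eventually.of_forall fun x => ?_)
    rw [norm_mul, Real.norm_of_nonneg (Real.exp_pos _).le]
    exact le_mul_of_one_le_right (norm_nonneg _) (Real.one_le_exp (by positivity))
  -- Used for g = h and g = -h; `ENNReal.ofReal` truncates g to its positive part.
  have key : ∀ g : ℝ → ℝ, AEStronglyMeasurable g μ → (∀ x, ‖g x‖ = ‖h x‖) →
      IsFiniteMeasure (μ.withDensity fun x => ENNReal.ofReal (g x)) ∧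
      0 ∈ interior (integrableExpSet id (μ.withDensity fun x => ENNReal.ofReal (g x))) ∧
      ∀ n : ℕ, Integrable (fun x => max (g x) 0 * x ^ n) μ ∧
        ∫ x, x ^ n ∂(μ.withDensity fun x => ENNReal.ofReal (g x)) =
          ∫ x, max (g x) 0 * x ^ n ∂μ := by
    intro g hg hgh
    have hgi : Integrable g μ := hint.mono hg (Eventually.of_forall fun x => (hgh x).le)
    have hfin : IsFiniteMeasure (μ.withDensity fun x => ENNReal.ofReal (g x)) :=
      isFiniteMeasure_withDensity_ofReal hgi.2
    have hmeas : AEMeasurable (fun x => ENNReal.ofReal (g x)) μ :=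
      hg.aemeasurable.ennreal_ofReal
    have hlt : ∀ᵐ x ∂μ, ENNReal.ofReal (g x) < ∞ :=
      Eventually.of_forall fun x => ENNReal.ofReal_lt_top
    have hin : 0 ∈ interior
        (integrableExpSet id (μ.withDensity fun x => ENNReal.ofReal (g x))) := by
      refine mem_interior.2 ⟨Ioo (-δ) δ, fun t ht => ?_, isOpen_Ioo, by simp [hδ]⟩
      show Integrable _ _
      rw [integrable_withDensity_iff_integrable_smul₀' hmeas hlt]
      refine hi.mono (by fun_prop) (Eventually.of_forall fun x => ?_)
      rw [norm_smul, norm_mul, Real.norm_of_nonneg (Real.exp_pos _).le,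
        Real.norm_of_nonneg (Real.exp_pos _).le, ENNReal.toReal_ofReal']
      refine mul_le_mul ?_ (Real.exp_le_exp.2 ?_) (Real.exp_pos _).le (norm_nonneg _)
      · rw [← hgh x, Real.norm_eq_abs, Real.norm_eq_abs, abs_of_nonneg (le_max_right _ _)]
        exact max_le (le_abs_self _) (abs_nonneg _)
      · refine (le_abs_self _).trans ?_
        rw [abs_mul]
        exact mul_le_mul_of_nonneg_right (abs_lt.2 ⟨ht.1, ht.2⟩).le (abs_nonneg _)
    refine ⟨hfin, hin, fun n => ⟨?_, ?_⟩⟩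
    · have := integrable_pow_of_mem_interior_integrableExpSet hin n
      rw [integrable_withDensity_iff_integrable_smul₀' hmeas hlt] at this
      simpa [ENNReal.toReal_ofReal'] using this
    · rw [integral_withDensity_eq_integral_toReal_smul₀ hmeas hlt]
      simp [ENNReal.toReal_ofReal']
  obtain ⟨f1, i1, m1⟩ := key h hm fun _ => rfl
  obtain ⟨f2, i2, m2⟩ := key (fun x => -h x) hm.neg fun x => norm_neg _
  have heq := measure_ext_of_moments i1 i2 fun n => by
    rw [(m1 n).2, (m2 n).2, ← sub_eq_zero, ← integral_sub (m1 n).1 (m2 n).1]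
    refine Eq.trans ?_ (h0 n)
    refine integral_congr_ae (Eventually.of_forall fun x => ?_)
    dsimp only
    rw [← sub_mul]
    congr 1
    rcases le_total (h x) 0 with hx | hx
    · rw [max_eq_right hx, max_eq_left (neg_nonneg.2 hx)]
      ring
    · rw [max_eq_left hx, max_eq_right (neg_nonpos.2 hx)]
      ring
  have heq' := (withDensity_eq_iff hm.aemeasurable.ennreal_ofReal
    hm.neg.aemeasurable.ennreal_ofReal (hint.lintegral_lt_top.ne)).1 heq
  filter_upwards [heq'] with x hx
  rw [Pi.neg_apply] at hx
  rcases le_total (h x) 0 with hx' | hx'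
  · rw [ENNReal.ofReal_of_nonpos hx', eq_comm, ENNReal.ofReal_eq_zero] at hx
    exact le_antisymm hx' (neg_nonpos.1 hx)
  · rw [ENNReal.ofReal_of_nonpos (neg_nonpos.2 hx'), ENNReal.ofReal_eq_zero] at hx
    exact le_antisymm hx hx'

theorem ae_eq_zero_of_complex_moments {μ : Measure ℝ} {h : ℝ → ℂ}
    (hm : AEStronglyMeasurable h μ) {δ : ℝ} (hδ : 0 < δ)
    (hi : Integrable (fun x => h x * (Real.exp (δ * |x|) : ℂ)) μ)
    (hi' : ∀ n : ℕ, Integrable (fun x => h x * ((x : ℂ) ^ n)) μ)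
    (h0 : ∀ n : ℕ, ∫ x, h x * ((x : ℂ) ^ n) ∂μ = 0) : h =ᵐ[μ] 0 := by
  have hre : (fun x => (h x).re) =ᵐ[μ] 0 := by
    refine ae_eq_zero_of_moments (Complex.continuous_re.comp_aestronglyMeasurable hm) hδ ?_
      fun n => ?_
    · simpa only [Complex.re_mul_ofReal, RCLike.re_to_complex] using hi.re
    · have := integral_re (hi' n)
      rw [h0 n] at this
      simpa only [← Complex.ofReal_pow, RCLike.re_to_complex, Complex.re_mul_ofReal,
        Complex.zero_re] using this
  have him : (fun x => (h x).im) =ᵐ[μ] 0 := by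
    refine ae_eq_zero_of_moments (Complex.continuous_im.comp_aestronglyMeasurable hm) hδ ?_
      fun n => ?_
    · simpa only [Complex.im_mul_ofReal, RCLike.im_to_complex] using hi.im
    · have := integral_im (hi' n)
      rw [h0 n] at this
      simpa only [← Complex.ofReal_pow, RCLike.im_to_complex, Complex.im_mul_ofReal,
        Complex.zero_im] using this
  filter_upwards [hre, him] with x h1 h2
  exact Complex.ext h1 h2

end Moments

/-! ### Closed operators with a complete system of eigenvectors -/

section Diagonal

open LinearPMap

variable {E ι : Type*} [NormedAddCommGroup E] [InnerProductSpace ℂ E]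
  {T : E →ₗ.[ℂ] E} (b : HilbertBasis ι ℂ E) {ev : ι → ℝ}

/-- The partial sums of the expansions of f and g form pairs in the graph, by linearity, and they
converge to (f, g). -/
theorem mem_graph_of_inner_eq (hcl : T.IsClosed)
    (hb : ∀ i, (b i, (ev i : ℂ) • b i) ∈ T.graph) {f g : E}
    (h : ∀ i, inner ℂ (b i) g = ev i * inner ℂ (b i) f) : (f, g) ∈ T.graph := by
  have h1 := (b.hasSum_repr f).prodMk (b.hasSum_repr g)
  refine IsClosed.mem_of_tendsto (s := (T.graph : Set (E × E))) hcl h1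
    (Eventually.of_forall fun s => T.graph.sum_mem fun i _ => ?_)
  have := T.graph.smul_mem (inner ℂ (b i) f) (hb i)
  rw [HilbertBasis.repr_apply_apply, HilbertBasis.repr_apply_apply, h i]
  rwa [Prod.smul_mk, smul_smul, mul_comm] at this

theorem dense_domain_of_eigenbasis (hb : ∀ i, (b i, (ev i : ℂ) • b i) ∈ T.graph) :
    Dense (T.domain : Set E) := by
  have h1 : Submodule.span ℂ (Set.range b) ≤ T.domain := by
    rw [Submodule.span_le]
    rintro _ ⟨i, rfl⟩
    exact mem_domain_of_mem_graph (hb i)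
  have h2 : Dense (Submodule.span ℂ (Set.range b) : Set E) :=
    Submodule.dense_iff_topologicalClosure_eq_top.2 b.dense_span
  exact h2.mono h1

/-- Pairing T† y with an eigenvector multiplies the coefficient of y by the eigenvalue, so (y, T† y)
already lies in the graph of T. The other inclusion is symmetry. -/
theorem isSelfAdjoint_of_eigenbasis [CompleteSpace E] (hcl : T.IsClosed)
    (hb : ∀ i, (b i, (ev i : ℂ) • b i) ∈ T.graph)
    (hs : ∀ (x : T.domain) (i : ι), inner ℂ (b i) (T x) = ev i * inner ℂ (b i) (x : E)) :
    IsSelfAdjoint T := by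
  have hd := dense_domain_of_eigenbasis b hb
  rw [isSelfAdjoint_def]
  have hsymm : T.IsFormalAdjoint T := by
    intro x y
    -- Both inner products are expanded by Parseval; the terms agree because the eigenvalues are
    -- real.
    refine (b.hasSum_inner_mul_inner (T x) y).unique ?_
    convert! b.hasSum_inner_mul_inner (x : E) (T y) using 2 with i
    rw [hs y i, ← inner_conj_symm (T x), hs x i, ← inner_conj_symm (x : E)]
    simp
    ring
  refine le_antisymm (le_of_le_graph fun p hp => ?_) (hsymm.le_adjoint hd)
  obtain ⟨y, h1, h2⟩ := (mem_graph_iff _).1 hp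
  refine mem_graph_of_inner_eq b hcl hb (f := p.1) (g := p.2) fun i => ?_
  have h3 := adjoint_isFormalAdjoint hd y ⟨b i, mem_domain_of_mem_graph (hb i)⟩
  have h4 : T ⟨b i, mem_domain_of_mem_graph (hb i)⟩ = (ev i : ℂ) • b i :=
    T.mem_graph_snd_inj (T.mem_graph _) (hb i) rfl
  rw [h4, h1, h2] at h3
  dsimp only at h3
  rw [← inner_conj_symm, h3, inner_smul_right, map_mul, inner_conj_symm, Complex.conj_ofReal]

theorem pmapPointSpectrum_of_eigenbasis
    (hb : ∀ i, (b i, (ev i : ℂ) • b i) ∈ T.graph)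
    (hs : ∀ (x : T.domain) (i : ι), inner ℂ (b i) (T x) = ev i * inner ℂ (b i) (x : E)) :
    pmapPointSpectrum T = Set.range fun i => (ev i : ℂ) := by
  ext z
  constructor
  · rintro ⟨x, hx0, hx⟩
    obtain ⟨i, hi⟩ : ∃ i, inner ℂ (b i) (x : E) ≠ 0 := by
      by_contra! hcon
      refine hx0 (b.repr.map_eq_zero_iff.1 (lp.ext (funext fun i => ?_)))
      rw [HilbertBasis.repr_apply_apply, hcon i]
      rfl
    have := hs x i
    rw [hx, inner_smul_right] at this
    exact ⟨i, (mul_right_cancel₀ hi this).symm⟩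
  · rintro ⟨i, rfl⟩
    refine ⟨⟨b i, mem_domain_of_mem_graph (hb i)⟩, ?_,
      T.mem_graph_snd_inj (T.mem_graph _) (hb i) rfl⟩
    exact b.orthonormal.ne_zero i

theorem pmapPointSpectrum_subset {F : Type*} [NormedAddCommGroup F] [NormedSpace ℂ F]
    (S : F →ₗ.[ℂ] F) : pmapPointSpectrum S ⊆ pmapSpectrum S := by
  rintro z ⟨x, hx0, hx⟩ ⟨R, hR, -⟩
  refine hx0 ?_
  rw [← hR x, hx, sub_self, _root_.map_zero]

/-- Off the closed set of eigenvalues, division of the i-th coefficient by λ_i - z is a bounded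
operator, and closedness puts its range into the domain. -/
theorem pmapSpectrum_of_eigenbasis (hcl : T.IsClosed)
    (hb : ∀ i, (b i, (ev i : ℂ) • b i) ∈ T.graph)
    (hs : ∀ (x : T.domain) (i : ι), inner ℂ (b i) (T x) = ev i * inner ℂ (b i) (x : E))
    (hev : IsClosed (Set.range fun i => (ev i : ℂ))) :
    pmapSpectrum T = Set.range fun i => (ev i : ℂ) := by
  refine Subset.antisymm ?_
    ((pmapPointSpectrum_of_eigenbasis b hb hs).symm.subset.trans (pmapPointSpectrum_subset T))
  intro z hz
  by_contra hz'
  refine hz ?_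
  obtain ⟨δ, hδ, hball⟩ := Metric.isOpen_iff.1 hev.isOpen_compl z hz'
  have hdist : ∀ i, δ ≤ ‖(ev i : ℂ) - z‖ := by
    intro i
    by_contra! hlt
    exact hball (by rwa [Metric.mem_ball, dist_eq_norm]) ⟨i, rfl⟩
  have hne : ∀ i, (ev i : ℂ) - z ≠ 0 := fun i => norm_pos_iff.1 (hδ.trans_le (hdist i))
  have hle : ∀ i (w : ℂ), ‖((ev i : ℂ) - z)⁻¹ * w‖ ≤ ‖(δ : ℂ)⁻¹ * w‖ := by
    intro i w
    rw [norm_mul, norm_mul, norm_inv, norm_inv, Complex.norm_real, Real.norm_of_nonneg hδ.le]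
    gcongr
    exact hdist i
  -- Square-summability survives because every |λ_i - z| is at least δ.
  let D (y : E) : lp (fun _ : ι => ℂ) 2 := ⟨fun i => ((ev i : ℂ) - z)⁻¹ * b.repr y i,
    ((lp.memℓp (b.repr y)).const_mul (δ : ℂ)⁻¹).mono' fun i => hle i _⟩
  have hD : ∀ y i, D y i = ((ev i : ℂ) - z)⁻¹ * b.repr y i := fun y i => rfl
  let R : E →ₗ[ℂ] E :=
    { toFun := fun y => b.repr.symm (D y)
      map_add' := by
        intro x y
        rw [← _root_.map_add]
        congr 1
        refine lp.ext (funext fun i => ?_)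
        rw [lp.coeFn_add, Pi.add_apply, hD, hD, hD, _root_.map_add, lp.coeFn_add, Pi.add_apply, mul_add]
      map_smul' := by
        intro c x
        rw [RingHom.id_apply, ← _root_.map_smul]
        congr 1
        refine lp.ext (funext fun i => ?_)
        rw [lp.coeFn_smul, Pi.smul_apply, hD, hD, _root_.map_smul, lp.coeFn_smul, Pi.smul_apply,
          smul_eq_mul, smul_eq_mul]
        ring }
  have hRi : ∀ y i, inner ℂ (b i) (R y) = ((ev i : ℂ) - z)⁻¹ * inner ℂ (b i) y := by
    intro y i
    rw [← HilbertBasis.repr_apply_apply, ← HilbertBasis.repr_apply_apply, ← hD]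
    show (b.repr (b.repr.symm (D y))) i = _
    rw [LinearIsometryEquiv.apply_symm_apply]
  have hext : ∀ x y : E, (∀ i, inner ℂ (b i) x = inner ℂ (b i) y) → x = y := by
    intro x y h
    refine b.repr.injective (lp.ext (funext fun i => ?_))
    rw [HilbertBasis.repr_apply_apply, HilbertBasis.repr_apply_apply, h i]
  have hbd : ∀ y, ‖R y‖ ≤ δ⁻¹ * ‖y‖ := by
    intro y
    show ‖b.repr.symm (D y)‖ ≤ _
    rw [LinearIsometryEquiv.norm_map]
    have h1 : ‖D y‖ ≤ ‖(δ : ℂ)⁻¹ • b.repr y‖ := lp.norm_mono (by norm_num) fun i => hle i _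
    rwa [norm_smul, norm_inv, Complex.norm_real, Real.norm_of_nonneg hδ.le,
      LinearIsometryEquiv.norm_map] at h1
  refine ⟨R.mkContinuous δ⁻¹ hbd, fun x => ?_, fun y => ?_⟩
  · refine hext _ _ fun i => ?_
    rw [LinearMap.mkContinuous_apply, hRi, inner_sub_right, hs, inner_smul_right, ← sub_mul,
      inv_mul_cancel_left₀ (hne i)]
  · have hg : (R y, y + z • R y) ∈ T.graph := by
      refine mem_graph_of_inner_eq b hcl hb fun i => ?_
      rw [inner_add_right, inner_smul_right, hRi]
      field_simp [hne i]
      ring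
    obtain ⟨x, h1, h2⟩ := (mem_graph_iff _).1 hg
    refine ⟨x, h1, ?_⟩
    dsimp only at h1 h2
    rw [h2, h1, add_sub_cancel_right]

end Diagonal

/-! ### Complex-valued absolutely continuous functions -/

theorem AbsolutelyContinuousOnInterval.of_dist_le {X Y : Type*} [PseudoMetricSpace X]
    [PseudoMetricSpace Y] {f : ℝ → X} {g : ℝ → Y} {a b : ℝ}
    (hf : AbsolutelyContinuousOnInterval f a b) (h : ∀ x y, dist (g x) (g y) ≤ dist (f x) (f y)) :
    AbsolutelyContinuousOnInterval g a b :=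
  squeeze_zero (fun _ => Finset.sum_nonneg fun _ _ => dist_nonneg)
    (fun _ => Finset.sum_le_sum fun _ _ => h _ _) hf

/-- The real and imaginary parts are primitives of integrable real functions. -/
theorem IntervalIntegrable.absolutelyContinuousOnInterval_complex {g : ℝ → ℂ} {a b c : ℝ}
    (hg : IntervalIntegrable g volume a b) (hc : c ∈ uIcc a b)
    (hgc : ∀ x, IntervalIntegrable g volume c x) :
    AbsolutelyContinuousOnInterval (fun x => ∫ t in c..x, g t) a b := by
  have hre : IntervalIntegrable (fun t => (g t).re) volume a b := ⟨hg.1.re, hg.2.re⟩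
  have him : IntervalIntegrable (fun t => (g t).im) volume a b := ⟨hg.1.im, hg.2.im⟩
  have h1 := (hre.absolutelyContinuousOnInterval_intervalIntegral hc).of_dist_le
    (g := fun x => ((∫ t in c..x, (g t).re : ℝ) : ℂ)) fun x y => by
      rw [Complex.dist_eq, ← Complex.ofReal_sub, Complex.norm_real, Real.dist_eq, Real.norm_eq_abs]
  have h2 := (him.absolutelyContinuousOnInterval_intervalIntegral hc).of_dist_le
    (g := fun x => ((∫ t in c..x, (g t).im : ℝ) : ℂ)) fun x y => by
      rw [Complex.dist_eq, ← Complex.ofReal_sub, Complex.norm_real, Real.dist_eq, Real.norm_eq_abs]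
  refine acOn_congr (h1.add (h2.const_smul Complex.I)) fun x _ => ?_
  have h3 : ∫ t in c..x, g t =
      ∫ t in c..x, (((g t).re : ℂ) + Complex.I * ((g t).im : ℂ)) := by
    congr 1
    ext t
    rw [mul_comm, Complex.re_add_im]
  have i1 : IntervalIntegrable (fun t => ((g t).re : ℂ)) volume c x :=
    ⟨(hgc x).1.re.ofReal, (hgc x).2.re.ofReal⟩
  have i2 : IntervalIntegrable (fun t => ((g t).im : ℂ)) volume c x :=
    ⟨(hgc x).1.im.ofReal, (hgc x).2.im.ofReal⟩
  rw [h3, intervalIntegral.integral_add i1 (i2.const_mul _), intervalIntegral.integral_const_mul,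
    intervalIntegral.integral_ofReal, intervalIntegral.integral_ofReal]
  rfl

/-- The fundamental theorem of calculus for an absolutely continuous function whose derivative is
almost everywhere equal to a given integrable function. -/
theorem AbsolutelyContinuousOnInterval.sub_eq_integral {f g : ℝ → ℂ} {a b : ℝ}
    (hf : AbsolutelyContinuousOnInterval f a b) (hg : Integrable g)
    (h : ∀ᵐ x, x ∈ uIcc a b → HasDerivAt f (g x) x) : f b - f a = ∫ t in a..b, g t := by
  -- f minus the primitive of g is absolutely continuous with derivative zero almost everywhere,
  -- hence constant.
  have h1 := hf.sub ((hg.intervalIntegrable (a := a) (b := b)).absolutelyContinuousOnInterval_complex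
    (left_mem_uIcc) fun x => hg.intervalIntegrable)
  obtain ⟨C, hC⟩ := h1.const_of_ae_hasDerivAt_zero (by
    filter_upwards [h, LocallyIntegrable.ae_hasDerivAt_integral hg.locallyIntegrable] with x hx hx' hmem
    simpa using (hx hmem).sub (hx' a))
  have ha := hC a left_mem_uIcc
  have hb := hC b right_mem_uIcc
  simp only [Pi.sub_apply, intervalIntegral.integral_same, sub_zero] at ha hb
  rw [ha, ← hb]
  ring

theorem acLocPos_of_contDiffOn {f : ℝ → ℂ} (hf : ContDiffOn ℝ 1 f (Ioi 0)) : ACLocPos f := by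
  intro a b ha hab
  refine ContDiffOn.absolutelyContinuousOnInterval (hf.mono ?_)
  rw [uIcc_of_le hab]
  exact fun x hx => lt_of_lt_of_le ha hx.1

theorem ACLocPos.sub {f g : ℝ → ℂ} (hf : ACLocPos f) (hg : ACLocPos g) : ACLocPos (f - g) :=
  fun a b ha hab => (hf a b ha hab).sub (hg a b ha hab)

theorem ACLocPos.mul {f g : ℝ → ℂ} (hf : ACLocPos f) (hg : ACLocPos g) :
    ACLocPos (fun x => f x * g x) :=
  fun a b ha hab => (hf a b ha hab).smul (hg a b ha hab)

theorem ACLocPos.continuousOn {f : ℝ → ℂ} (hf : ACLocPos f) : ContinuousOn f (Ioi 0) := by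
  intro x hx
  have hx' : (0 : ℝ) < x := hx
  have h := (hf (x / 2) (x + 1) (by linarith) (by linarith)).continuousOn
  rw [uIcc_of_le (by linarith)] at h
  exact (h.continuousAt (Icc_mem_nhds (by linarith) (by linarith))).continuousWithinAt

/-- A function that is locally absolutely continuous on `(0,∞)` with derivative almost everywhere
equal to an integrable function `g` is a primitive of `g`. -/
theorem ACLocPos.eq_add_integral {f g : ℝ → ℂ} (hf : ACLocPos f) (hg : Integrable g)
    (h : ∀ᵐ x ∂(volume.restrict (Ioi (0 : ℝ))), HasDerivAt f (g x) x) {a x : ℝ} (ha : 0 < a)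
    (hx : 0 < x) : f x = f a + ∫ t in a..x, g t := by
  rw [ae_restrict_iff' measurableSet_Ioi] at h
  have h' : ∀ c d : ℝ, 0 < c → c ≤ d → f d - f c = ∫ t in c..d, g t := fun c d hc hcd =>
    (hf c d hc hcd).sub_eq_integral hg (by
      filter_upwards [h] with y hy hmem
      rw [uIcc_of_le hcd] at hmem
      exact hy (lt_of_lt_of_le hc hmem.1))
  rcases le_total a x with hax | hax
  · rw [← h' a x ha hax]
    ring
  · rw [intervalIntegral.integral_symm, ← h' x a hx hax]
    ring

/-! ### The weight -/

/-- A real polynomial as a complex-valued function of a real variable. -/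
def polyFun (q : ℝ[X]) (x : ℝ) : ℂ := ((q.eval x : ℝ) : ℂ)

theorem hasDerivAt_polyFun (q : ℝ[X]) (x : ℝ) :
    HasDerivAt (polyFun q) (polyFun (derivative q) x) x :=
  (q.hasDerivAt x).ofReal_comp

theorem deriv_polyFun (q : ℝ[X]) : deriv (polyFun q) = polyFun (derivative q) :=
  funext fun x => (hasDerivAt_polyFun q x).deriv

theorem contDiff_polyFun (q : ℝ[X]) : ContDiff ℝ 1 (polyFun q) := by
  have h : ContDiff ℝ 1 fun x : ℝ => q.eval x := by
    simpa only [coe_aeval_eq_eval] using q.contDiff_aeval (𝕜 := ℝ) 1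
  exact Complex.ofRealCLM.contDiff.comp h

theorem continuous_polyFun (q : ℝ[X]) : Continuous (polyFun q) := (contDiff_polyFun q).continuous

theorem weightIII_pos (m : ℕ) {α : ℝ} (hα0 : α < 0) {x : ℝ} (hx : 0 < x) :
    0 < weightIII m α x := by
  have := etaIII_eval_pos m hα0 hx.le
  unfold weightIII
  positivity

theorem measurable_weightIII (m : ℕ) (α : ℝ) : Measurable (weightIII m α) := by
  unfold weightIII
  have := (etaIII m α).continuous.measurable
  fun_prop

theorem weightIII_le (m : ℕ) {α : ℝ} (hα0 : α < 0) {x : ℝ} (hx : 0 < x) :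
    weightIII m α x ≤ x ^ α * Real.exp (-x) / ((etaIII m α).coeff 0) ^ 2 := by
  have h0 := etaIII_coeff_zero_pos m hα0
  have h1 := etaIII_coeff_zero_le_eval m hα0 hx.le
  unfold weightIII
  gcongr

theorem toReal_ofReal_weightIII (m : ℕ) {α : ℝ} (hα0 : α < 0) :
    ∀ᵐ x ∂(volume.restrict (Ioi (0 : ℝ))),
      (ENNReal.ofReal (weightIII m α x)).toReal = weightIII m α x := by
  filter_upwards [ae_restrict_mem measurableSet_Ioi] with x hx
  exact ENNReal.toReal_ofReal (weightIII_pos m hα0 hx).le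

theorem integrable_muIII_iff (m : ℕ) {α : ℝ} (hα0 : α < 0) {g : ℝ → ℂ} :
    Integrable g (muIII m α) ↔ IntegrableOn (fun x => (weightIII m α x : ℂ) * g x) (Ioi 0) := by
  rw [muIII, integrable_withDensity_iff_integrable_smul'
    (measurable_weightIII m α).ennreal_ofReal (Eventually.of_forall fun x => ENNReal.ofReal_lt_top)]
  refine integrable_congr ?_
  filter_upwards [toReal_ofReal_weightIII m hα0] with x hx
  rw [hx, Complex.real_smul]

theorem integrable_muIII_iff_real (m : ℕ) {α : ℝ} (hα0 : α < 0) {g : ℝ → ℝ} :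
    Integrable g (muIII m α) ↔ IntegrableOn (fun x => weightIII m α x * g x) (Ioi 0) := by
  rw [muIII, integrable_withDensity_iff_integrable_smul'
    (measurable_weightIII m α).ennreal_ofReal (Eventually.of_forall fun x => ENNReal.ofReal_lt_top)]
  refine integrable_congr ?_
  filter_upwards [toReal_ofReal_weightIII m hα0] with x hx
  rw [hx, smul_eq_mul]

theorem integral_muIII (m : ℕ) {α : ℝ} (hα0 : α < 0) (g : ℝ → ℂ) :
    ∫ x, g x ∂(muIII m α) = ∫ x in Ioi 0, (weightIII m α x : ℂ) * g x := by
  rw [muIII, integral_withDensity_eq_integral_toReal_smul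
    (measurable_weightIII m α).ennreal_ofReal (Eventually.of_forall fun x => ENNReal.ofReal_lt_top)]
  refine integral_congr_ae ?_
  filter_upwards [toReal_ofReal_weightIII m hα0] with x hx
  rw [hx, Complex.real_smul]

theorem ae_muIII_pos (m : ℕ) (α : ℝ) : ∀ᵐ x ∂(muIII m α), 0 < x :=
  (ae_muIII_iff m α).2 (ae_restrict_mem measurableSet_Ioi)

/-- Half of the decay e^{-x} of the weight is given away and e^{-x/2} remains; at 0 the exponent α +
n exceeds -1. -/
theorem integrable_pow_mul_exp (m : ℕ) {α : ℝ} (hα : -1 < α) (hα0 : α < 0) (n : ℕ) :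
    Integrable (fun x : ℝ => x ^ n * Real.exp (1 / 2 * x)) (muIII m α) := by
  rw [integrable_muIII_iff_real m hα0]
  have h1 := integrableOn_rpow_mul_exp_neg_mul_rpow (s := α + n) (p := 1) (b := 1 / 2)
    (by have : (0 : ℝ) ≤ n := n.cast_nonneg
        linarith) one_pos (by norm_num)
  have h2 := h1.div_const (((etaIII m α).coeff 0) ^ 2)
  refine Integrable.mono h2 ?_ ?_
  · have := measurable_weightIII m α
    exact Measurable.aestronglyMeasurable (by fun_prop)
  · filter_upwards [ae_restrict_mem measurableSet_Ioi] with x hx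
    have hx' : (0 : ℝ) < x := hx
    have h0 := etaIII_coeff_zero_pos m hα0
    have hw := weightIII_pos m hα0 hx'
    rw [Real.norm_of_nonneg (by positivity), Real.norm_of_nonneg (by positivity)]
    have e1 : Real.exp (-(1 / 2) * x ^ (1 : ℝ)) = Real.exp (-x) * Real.exp (1 / 2 * x) := by
      rw [← Real.exp_add, Real.rpow_one]
      congr 1
      ring
    rw [Real.rpow_add_natCast hx'.ne', e1]
    calc weightIII m α x * (x ^ n * Real.exp (1 / 2 * x))
        ≤ x ^ α * Real.exp (-x) / ((etaIII m α).coeff 0) ^ 2 * (x ^ n * Real.exp (1 / 2 * x)) := by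
          have := weightIII_le m hα0 hx'
          gcongr
      _ = _ := by ring

theorem integrable_poly_mul_exp (m : ℕ) {α : ℝ} (hα : -1 < α) (hα0 : α < 0) (q : ℝ[X]) :
    Integrable (fun x : ℝ => q.eval x * Real.exp (1 / 2 * x)) (muIII m α) := by
  simp only [eval_eq_sum_range, Finset.sum_mul, mul_assoc]
  exact integrable_finsetSum _ fun n _ => (integrable_pow_mul_exp m hα hα0 n).const_mul _

/-- The rate 1/4 is half of 1/2 because of the square. This spare exponential is what the moment
theorem consumes. -/
theorem memLp_polyFun_mul_exp (m : ℕ) {α : ℝ} (hα : -1 < α) (hα0 : α < 0) (q : ℝ[X]) :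
    MemLp (fun x => polyFun q x * (Real.exp (1 / 4 * x) : ℂ)) 2 (muIII m α) := by
  have hc : Continuous fun x => polyFun q x * (Real.exp (1 / 4 * x) : ℂ) := by
    have := continuous_polyFun q
    fun_prop
  rw [memLp_two_iff_integrable_sq_norm hc.aestronglyMeasurable]
  convert! integrable_poly_mul_exp m hα hα0 (q ^ 2) using 2 with x
  rw [norm_mul, polyFun, Complex.norm_real, Complex.norm_real, mul_pow, Real.norm_eq_abs, sq_abs,
    Real.norm_of_nonneg (Real.exp_pos _).le, ← Real.exp_nat_mul, eval_pow]
  congr 2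
  push_cast
  ring

theorem memLp_polyFun (m : ℕ) {α : ℝ} (hα : -1 < α) (hα0 : α < 0) (q : ℝ[X]) :
    MemLp (polyFun q) 2 (muIII m α) := by
  refine (memLp_polyFun_mul_exp m hα hα0 q).mono (continuous_polyFun q).aestronglyMeasurable ?_
  filter_upwards [ae_muIII_pos m α] with x hx
  rw [norm_mul, Complex.norm_real, Real.norm_of_nonneg (Real.exp_pos _).le]
  exact le_mul_of_one_le_right (norm_nonneg _) (Real.one_le_exp (by positivity))

theorem isFiniteMeasure_muIII (m : ℕ) {α : ℝ} (hα : -1 < α) (hα0 : α < 0) :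
    IsFiniteMeasure (muIII m α) := by
  have h := memLp_polyFun m hα hα0 1
  have h1 : polyFun 1 = fun _ => (1 : ℂ) := by
    ext x
    simp [polyFun]
  rw [h1, memLp_const_iff two_ne_zero ENNReal.ofNat_ne_top] at h
  exact ⟨h.resolve_left one_ne_zero⟩

theorem maxDom_polyFun (m : ℕ) {α : ℝ} (hα : -1 < α) (hα0 : α < 0) (q : ℝ[X]) :
    MaxDom m α (polyFun q) where
  ac := acLocPos_of_contDiffOn (contDiff_polyFun q).contDiffOn
  diff := fun x _ => (hasDerivAt_polyFun q x).differentiableAt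
  acDeriv := by
    rw [deriv_polyFun]
    exact acLocPos_of_contDiffOn (contDiff_polyFun _).contDiffOn
  memLp := memLp_polyFun m hα hα0 q
  memLpEll := by
    -- Everything is polynomial except 2 x η' q' / η, which is controlled by the lower bound of η.
    have e : ellIII m α (polyFun q) = fun x =>
        polyFun (-(X * derivative (derivative q)) + (C (-1 - α) + X) * derivative q +
          C (-(m : ℝ) + α) * q) x +
        polyFun (C 2 * X * derivative (etaIII m α) * derivative q) x *
          (((etaIII m α).eval x)⁻¹ : ℝ) := by
      ext x
      simp only [ellIII, deriv_polyFun, polyFun, eval_add, eval_mul, eval_neg, eval_X, eval_C]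
      push_cast
      ring
    rw [e]
    refine (memLp_polyFun m hα hα0 _).add ?_
    refine (memLp_polyFun m hα hα0
      (C 2 * X * derivative (etaIII m α) * derivative q)).of_le_mul
      (c := ((etaIII m α).coeff 0)⁻¹) ?_ ?_
    · have h1 := (continuous_polyFun (C 2 * X * derivative (etaIII m α) * derivative q)).measurable
      have h2 := (etaIII m α).continuous.measurable
      exact Measurable.aestronglyMeasurable (by fun_prop)
    · filter_upwards [ae_muIII_pos m α] with x hx
      have h0 := etaIII_coeff_zero_pos m hα0
      have h1 := etaIII_coeff_zero_le_eval m hα0 hx.le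
      have h2 := h0.trans_le h1
      rw [norm_mul, mul_comm, Complex.norm_real, Real.norm_of_nonneg (by positivity)]
      gcongr

/-! ### Lagrange's identity and the limits of the sesquilinear form -/

/-- The leading coefficient `p(x) = x^{α+1} e^{-x} / η(x)^2` of the divergence form of `ℓ`. -/
noncomputable def leadIII (m : ℕ) (α : ℝ) (x : ℝ) : ℝ :=
  x ^ (α + 1) * Real.exp (-x) / ((etaIII m α).eval x) ^ 2

theorem leadIII_eq (m : ℕ) (α : ℝ) {x : ℝ} (hx : 0 < x) :
    leadIII m α x = x * weightIII m α x := by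
  rw [leadIII, weightIII, Real.rpow_add_one hx.ne']
  ring

theorem leadIII_pos (m : ℕ) {α : ℝ} (hα0 : α < 0) {x : ℝ} (hx : 0 < x) : 0 < leadIII m α x := by
  rw [leadIII_eq m α hx]
  exact mul_pos hx (weightIII_pos m hα0 hx)

/-- The derivative p' is -W times the coefficient of y' in ℓ; this is what puts ℓ into divergence
form. -/
theorem hasDerivAt_leadIII (m : ℕ) {α : ℝ} (hα0 : α < 0) {x : ℝ} (hx : 0 < x) :
    HasDerivAt (leadIII m α) (weightIII m α x *
      (1 + α - x - 2 * x * ((derivative (etaIII m α)).eval x / (etaIII m α).eval x))) x := by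
  have hη := etaIII_eval_pos m hα0 hx.le
  have h1 := Real.hasDerivAt_rpow_const (x := x) (p := α + 1) (Or.inl hx.ne')
  have h2 : HasDerivAt (fun x : ℝ => Real.exp (-x)) (-Real.exp (-x)) x := by
    simpa using (hasDerivAt_neg x).exp
  have h3 := ((etaIII m α).hasDerivAt x).pow 2
  convert! (h1.mul h2).div h3 (pow_ne_zero 2 hη.ne') using 1
  rw [weightIII, add_sub_cancel_right]
  simp only [Pi.mul_apply, Pi.pow_apply, Real.rpow_add_one hx.ne']
  field_simp
  push_cast
  ring

theorem contDiffOn_leadIII (m : ℕ) {α : ℝ} (hα0 : α < 0) :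
    ContDiffOn ℝ 1 (leadIII m α) (Ioi 0) := by
  unfold leadIII
  have h1 : ContDiffOn ℝ 1 (fun x : ℝ => x ^ (α + 1)) (Ioi 0) := fun x hx =>
    (Real.contDiffAt_rpow_const_of_ne (ne_of_gt hx)).contDiffWithinAt
  have h3 : ContDiff ℝ 1 fun x : ℝ => (etaIII m α).eval x := by
    simpa only [coe_aeval_eq_eval] using (etaIII m α).contDiff_aeval (𝕜 := ℝ) 1
  refine (h1.mul ?_).div (h3.pow 2).contDiffOn fun x hx =>
    pow_ne_zero 2 (etaIII_eval_pos m hα0 (le_of_lt hx)).ne'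
  exact (Real.contDiff_exp.comp contDiff_neg).contDiffOn

theorem acLocPos_leadIII (m : ℕ) {α : ℝ} (hα0 : α < 0) :
    ACLocPos fun x => (leadIII m α x : ℂ) :=
  acLocPos_of_contDiffOn (Complex.ofRealCLM.contDiff.comp_contDiffOn (contDiffOn_leadIII m hα0))

theorem MaxDom.acLocPos_quasiDeriv {m : ℕ} {α : ℝ} (hα0 : α < 0) {f : ℝ → ℂ}
    (hf : MaxDom m α f) : ACLocPos fun x => (leadIII m α x : ℂ) * deriv f x :=
  (acLocPos_leadIII m hα0).mul hf.acDeriv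

theorem MaxDom.hasDerivAt_quasiDeriv {m : ℕ} {α : ℝ} (hα0 : α < 0) {f : ℝ → ℂ}
    (hf : MaxDom m α f) : ∀ᵐ x ∂(volume.restrict (Ioi (0 : ℝ))),
      HasDerivAt (fun x => (leadIII m α x : ℂ) * deriv f x)
        (-(weightIII m α x : ℂ) * (ellIII m α f x - ((-(m : ℝ) + α : ℝ) : ℂ) * f x)) x := by
  filter_upwards [hf.acDeriv.ae_differentiableAt, ae_restrict_mem measurableSet_Ioi] with x h1 hx
  have hx' : (0 : ℝ) < x := hx
  convert! (hasDerivAt_leadIII m hα0 hx').ofReal_comp.mul h1.hasDerivAt using 1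
  rw [leadIII_eq m α hx', ellIII]
  push_cast
  ring

/-- The Wronskian `p (f g' - f' g)`. -/
noncomputable def wronskianIII (m : ℕ) (α : ℝ) (f g : ℝ → ℂ) (x : ℝ) : ℂ :=
  f x * ((leadIII m α x : ℂ) * deriv g x) - (leadIII m α x : ℂ) * deriv f x * g x

/-- Lagrange's identity: the terms p f' g' and the zeroth-order terms of ℓ cancel. -/
theorem MaxDom.hasDerivAt_wronskianIII {m : ℕ} {α : ℝ} (hα0 : α < 0) {f g : ℝ → ℂ}
    (hf : MaxDom m α f) (hg : MaxDom m α g) : ∀ᵐ x ∂(volume.restrict (Ioi (0 : ℝ))),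
      HasDerivAt (wronskianIII m α f g)
        ((weightIII m α x : ℂ) * (g x * ellIII m α f x - f x * ellIII m α g x)) x := by
  filter_upwards [hf.hasDerivAt_quasiDeriv hα0, hg.hasDerivAt_quasiDeriv hα0,
    ae_restrict_mem measurableSet_Ioi] with x h1 h2 hx
  convert! ((hf.diff x hx).hasDerivAt.mul h2).sub (h1.mul (hg.diff x hx).hasDerivAt) using 1
  ring

/-- A function that is locally absolutely continuous on `(0,∞)` with integrable derivative has
limits at both endpoints. -/
theorem ACLocPos.exists_tendsto {f g : ℝ → ℂ} (hf : ACLocPos f) (hg : IntegrableOn g (Ioi 0))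
    (h : ∀ᵐ x ∂(volume.restrict (Ioi (0 : ℝ))), HasDerivAt f (g x) x) :
    ∃ A B : ℂ, Tendsto f (𝓝[>] 0) (𝓝 A) ∧ Tendsto f atTop (𝓝 B) ∧
      B = A + ∫ t in Ioi 0, g t ∧ ∀ x, 0 < x → f x = A + ∫ t in (0 : ℝ)..x, g t := by
  -- Extension by zero gives a function integrable on the whole line, so its primitive is continuous
  -- at 0.
  set k : ℝ → ℂ := (Ioi (0 : ℝ)).indicator g with hk
  have hki : Integrable k := (integrable_indicator_iff measurableSet_Ioi).2 hg
  have hkd : ∀ᵐ x ∂(volume.restrict (Ioi (0 : ℝ))), HasDerivAt f (k x) x := by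
    filter_upwards [h, ae_restrict_mem measurableSet_Ioi] with x hx hx0
    rwa [hk, indicator_of_mem hx0]
  have e1 : ∀ x, 0 < x → f x = (f 1 - ∫ t in (0 : ℝ)..1, k t) + ∫ t in (0 : ℝ)..x, k t := by
    intro x hx
    rw [hf.eq_add_integral hki hkd one_pos hx, ← intervalIntegral.integral_add_adjacent_intervals
      (hki.intervalIntegrable (a := 0) (b := 1)) (hki.intervalIntegrable (a := 1) (b := x))]
    ring
  have e2 : ∀ x : ℝ, 0 < x → ∫ t in (0 : ℝ)..x, k t = ∫ t in (0 : ℝ)..x, g t := by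
    intro x hx
    refine intervalIntegral.integral_congr_ae (Eventually.of_forall fun t ht => ?_)
    rw [uIoc_of_le hx.le] at ht
    exact indicator_of_mem (s := Ioi (0 : ℝ)) ht.1 g
  refine ⟨f 1 - ∫ t in (0 : ℝ)..1, k t, _, ?_, ?_, rfl, fun x hx => by rw [e1 x hx, e2 x hx]⟩
  · have hc := (hki.continuous_primitive 0).tendsto 0
    rw [intervalIntegral.integral_same] at hc
    have := (hc.const_add (f 1 - ∫ t in (0 : ℝ)..1, k t)).mono_left
      (nhdsWithin_le_nhds (s := Ioi (0 : ℝ)))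
    rw [add_zero] at this
    refine this.congr' ?_
    filter_upwards [self_mem_nhdsWithin] with x hx using (e1 x hx).symm
  · have := (intervalIntegral_tendsto_integral_Ioi 0 hg tendsto_id).const_add
      (f 1 - ∫ t in (0 : ℝ)..1, k t)
    refine this.congr' ?_
    filter_upwards [eventually_gt_atTop 0] with x hx
    rw [e1 x hx, e2 x hx, id]

/-- By Lagrange's identity the derivative of the Wronskian is W times products of L² functions,
hence integrable. -/
theorem MaxDom.exists_tendsto_wronskianIII {m : ℕ} {α : ℝ} (hα0 : α < 0) {f g : ℝ → ℂ}
    (hf : MaxDom m α f) (hg : MaxDom m α g) :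
    ∃ A B : ℂ, Tendsto (wronskianIII m α f g) (𝓝[>] 0) (𝓝 A) ∧
      Tendsto (wronskianIII m α f g) atTop (𝓝 B) ∧
      B = A + ∫ x, (g x * ellIII m α f x - f x * ellIII m α g x) ∂(muIII m α) := by
  have hac : ACLocPos (wronskianIII m α f g) :=
    (hf.ac.mul (hg.acLocPos_quasiDeriv hα0)).sub ((hf.acLocPos_quasiDeriv hα0).mul hg.ac)
  have hint : Integrable (fun x => g x * ellIII m α f x - f x * ellIII m α g x) (muIII m α) :=
    (hg.memLp.integrable_mul hf.memLpEll).sub (hf.memLp.integrable_mul hg.memLpEll)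
  obtain ⟨A, B, h1, h2, h3, -⟩ := hac.exists_tendsto ((integrable_muIII_iff m hα0).1 hint)
    (hf.hasDerivAt_wronskianIII hα0 hg)
  exact ⟨A, B, h1, h2, by rw [h3, integral_muIII m hα0]⟩

theorem eq_zero_of_tendsto_atTop_of_integrableOn {f : ℝ → ℂ} (hf : IntegrableOn f (Ioi 0)) {a : ℂ}
    (ha : Tendsto f atTop (𝓝 a)) : a = 0 := by
  refine IntegrableAtFilter.eq_zero_of_tendsto (μ := volume) ⟨Ioi 0, Ioi_mem_atTop 0, hf⟩
    (fun s hs => ?_) ha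
  obtain ⟨b, hb⟩ := mem_atTop_sets.1 hs
  exact measure_mono_top (fun x hx => hb x hx) (Real.volume_Ici (a := b))

/-- The Wronskian of a function of the maximal domain and a polynomial vanishes at infinity. -/
theorem MaxDom.tendsto_wronskianIII_atTop {m : ℕ} {α : ℝ} (hα : -1 < α) (hα0 : α < 0) {f : ℝ → ℂ}
    (hf : MaxDom m α f) (q : ℝ[X]) :
    Tendsto (wronskianIII m α f (polyFun q)) atTop (𝓝 0) := by
  have hq := maxDom_polyFun m hα hα0 q
  obtain ⟨-, B, -, hB, -⟩ := hf.exists_tendsto_wronskianIII hα0 hq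
  -- Write w(q) for the Wronskian of f and q. From (x q)' = q + x q' and p = x W, w(x q)/x - w(q) =
  -- W f q. The left side tends to -B and the right side is integrable, so B = 0.
  obtain ⟨-, D, -, hD, -⟩ := hf.exists_tendsto_wronskianIII hα0 (maxDom_polyFun m hα hα0 (X * q))
  have hint := (integrable_muIII_iff m hα0).1 (hf.memLp.integrable_mul hq.memLp)
  have hinv : Tendsto (fun x : ℝ => ((x⁻¹ : ℝ) : ℂ)) atTop (𝓝 ((0 : ℝ) : ℂ)) :=
    (Complex.continuous_ofReal.tendsto 0).comp tendsto_inv_atTop_zero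
  have hlim := (hinv.mul hD).sub hB
  have h0 : ((0 : ℝ) : ℂ) * D - B = 0 := by
    refine eq_zero_of_tendsto_atTop_of_integrableOn hint (hlim.congr' ?_)
    filter_upwards [eventually_gt_atTop 0] with x hx
    have hx' : (x : ℂ) ≠ 0 := by exact_mod_cast hx.ne'
    have e : polyFun (X * q) x = x * polyFun q x := by simp [polyFun]
    have e' : polyFun (derivative (X * q)) x = polyFun q x + x * polyFun (derivative q) x := by
      simp [polyFun, derivative_mul]
    simp only [wronskianIII, deriv_polyFun, e, e', leadIII_eq m α hx, Pi.mul_apply]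
    push_cast
    field_simp
    ring
  rw [Complex.ofReal_zero, zero_mul, zero_sub, neg_eq_zero] at h0
  rwa [h0] at hB

theorem MaxDom.integrable_quasiDeriv_deriv {m : ℕ} {α : ℝ} (hα : -1 < α) (hα0 : α < 0)
    {f : ℝ → ℂ} (hf : MaxDom m α f) :
    IntegrableOn (fun x => -(weightIII m α x : ℂ) *
      (ellIII m α f x - ((-(m : ℝ) + α : ℝ) : ℂ) * f x)) (Ioi 0) := by
  have := isFiniteMeasure_muIII m hα hα0
  have h := (integrable_muIII_iff m hα0).1
    ((hf.memLpEll.sub (hf.memLp.const_mul ((-(m : ℝ) + α : ℝ) : ℂ))).integrable one_le_two).neg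
  refine h.congr (Eventually.of_forall fun x => ?_)
  simp only [Pi.neg_apply, Pi.sub_apply]
  ring

/-! ### Boundary behaviour at 0. -/

theorem tendsto_leadIII_div (m : ℕ) {α : ℝ} (hα0 : α < 0) :
    Tendsto (fun x : ℝ => ((Real.exp (-x) / ((etaIII m α).eval x) ^ 2 : ℝ) : ℂ)) (𝓝[>] 0)
      (𝓝 ((1 / ((etaIII m α).eval 0) ^ 2 : ℝ) : ℂ)) := by
  have hc : ContinuousAt (fun x : ℝ => Real.exp (-x) / ((etaIII m α).eval x) ^ 2) 0 := by
    refine ContinuousAt.div (by fun_prop) ((etaIII m α).continuous.pow 2).continuousAt ?_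
    exact pow_ne_zero 2 (etaIII_eval_pos m hα0 le_rfl).ne'
  have h := hc.tendsto
  rw [neg_zero, Real.exp_zero] at h
  exact (Complex.continuous_ofReal.tendsto _).comp (h.mono_left nhdsWithin_le_nhds)

/-- The quotient p(x)/x^{α+1} tends to the nonzero number 1/η(0)². -/
theorem boundaryCond_iff (m : ℕ) {α : ℝ} (hα0 : α < 0) (f : ℝ → ℂ) :
    BoundaryCond α f ↔
      Tendsto (fun x => (leadIII m α x : ℂ) * deriv f x) (𝓝[>] 0) (𝓝 0) := by
  have h := tendsto_leadIII_div m hα0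
  have hne : ((1 / ((etaIII m α).eval 0) ^ 2 : ℝ) : ℂ) ≠ 0 := by
    have := etaIII_eval_pos m hα0 le_rfl
    exact_mod_cast (by positivity)
  constructor
  · intro hf
    have := h.mul hf
    rw [mul_zero] at this
    refine this.congr fun x => ?_
    rw [leadIII]
    push_cast
    ring
  · intro hf
    have := (h.inv₀ hne).mul hf
    rw [mul_zero] at this
    refine this.congr' ?_
    filter_upwards [self_mem_nhdsWithin] with x hx
    have h1 := etaIII_eval_pos m hα0 (le_of_lt hx)
    have h2 : (((etaIII m α).eval x : ℝ) : ℂ) ≠ 0 := by exact_mod_cast h1.ne'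
    rw [leadIII]
    push_cast
    have h3 := Complex.exp_ne_zero (-(x : ℂ))
    field_simp

/-- Near 0 the boundary condition gives |f'| ≤ x^{-α-1}, which is integrable there because α < 0. -/
theorem MaxDom.exists_tendsto_zero {m : ℕ} {α : ℝ} (hα0 : α < 0) {f : ℝ → ℂ}
    (hf : MaxDom m α f) (hb : BoundaryCond α f) : ∃ A : ℂ, Tendsto f (𝓝[>] 0) (𝓝 A) := by
  have hev : ∀ᶠ x : ℝ in 𝓝[>] 0, ‖((x ^ (α + 1) : ℝ) : ℂ) * deriv f x‖ < 1 := by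
    have h := (tendsto_zero_iff_norm_tendsto_zero.1 hb)
    exact h.eventually (gt_mem_nhds one_pos)
  obtain ⟨δ, hδ, hlt⟩ := mem_nhdsGT_iff_exists_Ioc_subset.1 hev
  have hδ' : (0 : ℝ) < δ := hδ
  have hi1 : IntegrableOn (fun x : ℝ => x ^ (-α - 1)) (Ioc 0 δ) :=
    (intervalIntegrable_iff_integrableOn_Ioc_of_le hδ'.le).1
      (intervalIntegral.intervalIntegrable_rpow' (by linarith))
  have hi : IntegrableOn (deriv f) (Ioc 0 δ) := by
    refine Integrable.mono hi1 ((hf.acDeriv.continuousOn.mono fun x hx =>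
      hx.1).aestronglyMeasurable measurableSet_Ioc) ?_
    filter_upwards [ae_restrict_mem measurableSet_Ioc] with x hx
    have h1 : ‖((x ^ (α + 1) : ℝ) : ℂ) * deriv f x‖ < 1 := hlt hx
    have hpos : 0 < x ^ (α + 1) := Real.rpow_pos_of_pos hx.1 _
    rw [norm_mul, Complex.norm_real, Real.norm_of_nonneg hpos.le] at h1
    rw [Real.norm_of_nonneg (Real.rpow_pos_of_pos hx.1 _).le,
      show -α - 1 = -(α + 1) by ring, Real.rpow_neg hx.1.le, ← one_div, le_div_iff₀ hpos, mul_comm]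
    exact h1.le
  set k : ℝ → ℂ := (Ioc (0 : ℝ) δ).indicator (deriv f) with hk
  have hki : Integrable k := (integrable_indicator_iff measurableSet_Ioc).2 hi
  have e : ∀ x ∈ Ioc 0 δ, f δ - f x = ∫ t in x..δ, k t := by
    intro x hx
    refine (hf.ac x δ hx.1 hx.2).sub_eq_integral hki (Eventually.of_forall fun t ht => ?_)
    rw [uIcc_of_le hx.2] at ht
    have ht' : t ∈ Ioc 0 δ := ⟨hx.1.trans_le ht.1, ht.2⟩
    rw [hk, indicator_of_mem ht']
    exact (hf.diff t ht'.1).hasDerivAt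
  refine ⟨f δ + ∫ t in δ..0, k t, ?_⟩
  have hc := (((hki.continuous_primitive δ).tendsto 0).const_add (f δ)).mono_left
    (nhdsWithin_le_nhds (s := Ioi (0 : ℝ)))
  refine hc.congr' ?_
  filter_upwards [Ioc_mem_nhdsGT hδ'] with x hx
  rw [intervalIntegral.integral_symm, ← e x hx]
  ring

theorem tendsto_leadIII_zero (m : ℕ) {α : ℝ} (hα : -1 < α) (hα0 : α < 0) :
    Tendsto (fun x => (leadIII m α x : ℂ)) (𝓝[>] 0) (𝓝 0) := by
  have h1 : Tendsto (fun x : ℝ => ((x ^ (α + 1) : ℝ) : ℂ)) (𝓝[>] 0) (𝓝 ((0 : ℝ) : ℂ)) := by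
    refine (Complex.continuous_ofReal.tendsto 0).comp ?_
    have h := (Real.continuousAt_rpow_const (0 : ℝ) (α + 1) (Or.inr (by linarith))).tendsto
    rw [Real.zero_rpow (by linarith)] at h
    exact h.mono_left nhdsWithin_le_nhds
  have h2 := h1.mul (tendsto_leadIII_div m hα0)
  rw [Complex.ofReal_zero, zero_mul] at h2
  refine h2.congr fun x => ?_
  rw [leadIII]
  push_cast
  ring

theorem MaxDom.tendsto_wronskianIII_zero {m : ℕ} {α : ℝ} (hα : -1 < α) (hα0 : α < 0) {f : ℝ → ℂ}
    (hf : MaxDom m α f) (hb : BoundaryCond α f) (q : ℝ[X]) :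
    Tendsto (wronskianIII m α f (polyFun q)) (𝓝[>] 0) (𝓝 0) := by
  obtain ⟨A, hA⟩ := hf.exists_tendsto_zero hα0 hb
  have hq : ∀ r : ℝ[X], Tendsto (polyFun r) (𝓝[>] 0) (𝓝 (polyFun r 0)) := fun r =>
    ((continuous_polyFun r).tendsto 0).mono_left nhdsWithin_le_nhds
  have h := (hA.mul ((tendsto_leadIII_zero m hα hα0).mul (hq (derivative q)))).sub
    (((boundaryCond_iff m hα0 f).1 hb).mul (hq q))
  simp only [zero_mul, mul_zero, sub_zero] at h
  refine h.congr fun x => ?_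
  rw [wronskianIII, deriv_polyFun]

/-- Green's formula for a function of the domain of the Type III operator and a polynomial. -/
theorem MaxDom.integral_mul_ellIII {m : ℕ} {α : ℝ} (hα : -1 < α) (hα0 : α < 0) {f : ℝ → ℂ}
    (hf : MaxDom m α f) (hb : BoundaryCond α f) (q : ℝ[X]) :
    ∫ x, polyFun q x * ellIII m α f x ∂(muIII m α) =
      ∫ x, f x * ellIII m α (polyFun q) x ∂(muIII m α) := by
  have hq := maxDom_polyFun m hα hα0 q
  obtain ⟨A, B, h1, h2, h3⟩ := hf.exists_tendsto_wronskianIII hα0 hq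
  rw [tendsto_nhds_unique h1 (hf.tendsto_wronskianIII_zero hα hα0 hb q),
    tendsto_nhds_unique h2 (hf.tendsto_wronskianIII_atTop hα hα0 q), zero_add] at h3
  exact sub_eq_zero.1 ((integral_sub (hq.memLp.integrable_mul hf.memLpEll)
    (hf.memLp.integrable_mul hq.memLpEll)).symm.trans h3.symm)

/-- Test against g = 1: the bracket is -p f'. Its limit at infinity is 0 for every f of the maximal
domain, so the equal limit at 0 is 0 as well. -/
theorem minDomain_le_typeIIIDomain (m : ℕ) {α : ℝ} (hα : -1 < α) (hα0 : α < 0) :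
    minDomain m α ≤ typeIIIDomain m α := by
  rintro u ⟨f, hf, hfb, hu⟩
  refine ⟨f, hf, ?_, hu⟩
  have e : ∀ x, bracketIII m α f (polyFun 1) x = wronskianIII m α f (polyFun 1) x := by
    intro x
    simp only [bracketIII, wronskianIII, deriv_polyFun, polyFun, leadIII, Complex.conj_ofReal]
    ring
  obtain ⟨c, h1, h2⟩ := hfb _ (maxDom_polyFun m hα hα0 1)
  have hc : c = 0 :=
    tendsto_nhds_unique (h1.congr e) (hf.tendsto_wronskianIII_atTop hα hα0 1)
  rw [boundaryCond_iff m hα0]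
  have h3 := (h2.congr e).neg
  rw [hc, neg_zero] at h3
  refine h3.congr fun x => ?_
  simp [wronskianIII, deriv_polyFun, polyFun]

theorem minOp_le_typeIIIOp (m : ℕ) {α : ℝ} (hα : -1 < α) (hα0 : α < 0) :
    minOp m α ≤ typeIIIOp m α := by
  refine ⟨inf_le_inf_right _ (minDomain_le_typeIIIDomain m hα hα0), fun x y hxy => ?_⟩
  have hx : (x : HIII m α) ∈ (maxOp m α).domain := x.2.2
  have h1 : minOp m α x = maxOp m α ⟨(x : HIII m α), hx⟩ := LinearPMap.domRestrict_apply rfl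
  have h2 : typeIIIOp m α y = maxOp m α ⟨(x : HIII m α), hx⟩ :=
    LinearPMap.domRestrict_apply hxy.symm
  rw [h1, h2]

/-! ### The Type III operator is closed -/

theorem mem_graph_typeIIIOp_iff (m : ℕ) (α : ℝ) (u v : HIII m α) :
    (u, v) ∈ (typeIIIOp m α).graph ↔ ∃ f : ℝ → ℂ, MaxDom m α f ∧ BoundaryCond α f ∧
      u =ᵐ[muIII m α] f ∧ v =ᵐ[muIII m α] ellIII m α f := by
  have hval : ∀ (w : (typeIIIOp m α).domain) (hw : (w : HIII m α) ∈ (maxOp m α).domain),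
      typeIIIOp m α w = maxOp m α ⟨(w : HIII m α), hw⟩ := fun w hw =>
    LinearPMap.domRestrict_apply rfl
  constructor
  · intro h
    obtain ⟨w, rfl, rfl⟩ := (LinearPMap.mem_graph_iff _).1 h
    obtain ⟨f, hf, hb, hu⟩ : (w : HIII m α) ∈ typeIIIDomain m α := w.2.1
    refine ⟨f, hf, hb, hu, ?_⟩
    rw [hval w w.2.2]
    exact maxOp_apply_ae _ hf hu
  · rintro ⟨f, hf, hb, hu, hv⟩
    have hm : u ∈ maxDomain m α := ⟨f, hf, hu⟩
    have hd : u ∈ (typeIIIOp m α).domain := by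
      rw [typeIIIOp_domain]
      exact ⟨f, hf, hb, hu⟩
    have h1 : typeIIIOp m α ⟨u, hd⟩ = maxOp m α ⟨u, hm⟩ := hval ⟨u, hd⟩ hm
    have h2 := maxOpFun_ae ⟨u, hm⟩ hf hu
    have h3 : maxOp m α ⟨u, hm⟩ = v := Lp.ext (h2.trans hv.symm)
    exact (LinearPMap.mem_graph_iff _).2 ⟨⟨u, hd⟩, rfl, h1.trans h3⟩

/-! ### Recovering a function from its image by two integrations. -/

theorem exists_integral_norm_le {μ : Measure ℝ} [IsFiniteMeasure μ] :
    ∃ K : ℝ, ∀ h : Lp ℂ 2 μ, ∫ x, ‖h x‖ ∂μ ≤ K * ‖h‖ := by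
  refine ⟨(μ univ ^ (1 / (1 : ℝ≥0∞).toReal - 1 / (2 : ℝ≥0∞).toReal)).toReal, fun h => ?_⟩
  have h1 := eLpNorm_le_eLpNorm_mul_rpow_measure_univ (one_le_two : (1 : ℝ≥0∞) ≤ 2)
    (Lp.aestronglyMeasurable h)
  rw [integral_norm_eq_lintegral_enorm (Lp.aestronglyMeasurable h), ← eLpNorm_one_eq_lintegral_enorm,
    Lp.norm_def, mul_comm, ← ENNReal.toReal_mul]
  refine ENNReal.toReal_mono (ENNReal.mul_ne_top (Lp.eLpNorm_ne_top h) ?_) h1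
  refine ENNReal.rpow_ne_top_of_nonneg ?_ (measure_ne_top _ _)
  norm_num

theorem integral_norm_muIII (m : ℕ) {α : ℝ} (hα0 : α < 0) (g : ℝ → ℂ) :
    ∫ x, ‖g x‖ ∂(muIII m α) = ∫ x in Ioi 0, ‖(weightIII m α x : ℂ) * g x‖ := by
  rw [muIII, integral_withDensity_eq_integral_toReal_smul
    (measurable_weightIII m α).ennreal_ofReal (Eventually.of_forall fun x => ENNReal.ofReal_lt_top)]
  refine integral_congr_ae ?_
  filter_upwards [toReal_ofReal_weightIII m hα0, ae_restrict_mem measurableSet_Ioi] with x hx hx0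
  rw [hx, norm_mul, Complex.norm_real, Real.norm_of_nonneg (weightIII_pos m hα0 hx0).le,
    smul_eq_mul]

/-- The integral `∫_0^x W h`. -/
noncomputable def fluxIII (m : ℕ) (α : ℝ) (h : ℝ → ℂ) (x : ℝ) : ℂ :=
  ∫ t in (0 : ℝ)..x, (weightIII m α t : ℂ) * h t

/-- The quotient `p(x)⁻¹ ∫_0^x W h`. -/
noncomputable def slopeIII (m : ℕ) (α : ℝ) (h : ℝ → ℂ) (x : ℝ) : ℂ :=
  fluxIII m α h x / (leadIII m α x : ℂ)

section Flux

variable {m : ℕ} {α : ℝ} {h : ℝ → ℂ}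

theorem fluxIII_congr {h' : ℝ → ℂ} (hh : h =ᵐ[muIII m α] h') {x : ℝ} (hx : 0 < x) :
    fluxIII m α h x = fluxIII m α h' x := by
  have h1 := (ae_muIII_iff m α).1 hh
  rw [ae_restrict_iff' measurableSet_Ioi] at h1
  refine intervalIntegral.integral_congr_ae ?_
  filter_upwards [h1] with t ht hmem
  rw [uIoc_of_le hx.le] at hmem
  rw [ht hmem.1]

/-- Integrability of W h is known only on the half-line; extension by zero makes it global. -/
theorem fluxIII_eq_indicator {x : ℝ} (hx : 0 ≤ x) : fluxIII m α h x =
    ∫ t in (0 : ℝ)..x, (Ioi (0 : ℝ)).indicator (fun t => (weightIII m α t : ℂ) * h t) t := by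
  refine intervalIntegral.integral_congr_ae (Eventually.of_forall fun t ht => ?_)
  rw [uIoc_of_le hx] at ht
  rw [indicator_of_mem (show t ∈ Ioi (0 : ℝ) from ht.1)]

theorem integrable_indicator_weightIII (hα0 : α < 0) (hh : Integrable h (muIII m α)) :
    Integrable ((Ioi (0 : ℝ)).indicator fun t => (weightIII m α t : ℂ) * h t) :=
  (integrable_indicator_iff measurableSet_Ioi).2 ((integrable_muIII_iff m hα0).1 hh)

theorem acLocPos_fluxIII (hα0 : α < 0) (hh : Integrable h (muIII m α)) :
    ACLocPos (fluxIII m α h) := by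
  have hi := integrable_indicator_weightIII hα0 hh
  refine ACLocPos.congr (f := fun x => ∫ t in (0 : ℝ)..x,
    (Ioi (0 : ℝ)).indicator (fun t => (weightIII m α t : ℂ) * h t) t) (fun a b ha hab => ?_)
    fun x hx => fluxIII_eq_indicator hx.le
  refine (hi.intervalIntegrable (a := 0) (b := b)).absolutelyContinuousOnInterval_complex
    left_mem_uIcc (fun _ => hi.intervalIntegrable) |>.mono ?_
  rw [uIcc_of_le hab, uIcc_of_le (ha.le.trans hab)]
  exact Icc_subset_Icc_left ha.le

theorem hasDerivAt_fluxIII (hα0 : α < 0) (hh : Integrable h (muIII m α)) :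
    ∀ᵐ x ∂(volume.restrict (Ioi (0 : ℝ))),
      HasDerivAt (fluxIII m α h) ((weightIII m α x : ℂ) * h x) x := by
  have hi := integrable_indicator_weightIII hα0 hh
  filter_upwards [ae_restrict_of_ae (LocallyIntegrable.ae_hasDerivAt_integral hi.locallyIntegrable),
    ae_restrict_mem measurableSet_Ioi] with x h1 hx
  have h2 := h1 0
  rw [indicator_of_mem hx] at h2
  refine h2.congr_of_eventuallyEq ?_
  filter_upwards [Ioi_mem_nhds hx] with y hy using fluxIII_eq_indicator (le_of_lt hy)

theorem tendsto_fluxIII_zero (hα0 : α < 0) (hh : Integrable h (muIII m α)) :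
    Tendsto (fluxIII m α h) (𝓝[>] 0) (𝓝 0) := by
  have hc := ((integrable_indicator_weightIII hα0 hh).continuous_primitive 0).tendsto 0
  rw [intervalIntegral.integral_same] at hc
  refine (hc.mono_left (nhdsWithin_le_nhds (s := Ioi (0 : ℝ)))).congr' ?_
  filter_upwards [self_mem_nhdsWithin] with x hx using (fluxIII_eq_indicator (le_of_lt hx)).symm

/-- The bound does not depend on x, so L¹ convergence of h gives uniform convergence of the fluxes.
-/
theorem norm_fluxIII_sub_le (hα0 : α < 0) (hh : Integrable h (muIII m α)) {h' : ℝ → ℂ}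
    (hh' : Integrable h' (muIII m α)) {x : ℝ} (hx : 0 < x) :
    ‖fluxIII m α h x - fluxIII m α h' x‖ ≤ ∫ t, ‖h t - h' t‖ ∂(muIII m α) := by
  have hi := (integrable_muIII_iff m hα0).1 hh
  have hi' := (integrable_muIII_iff m hα0).1 hh'
  have hs := (integrable_muIII_iff m hα0).1 (hh.sub hh')
  rw [fluxIII, fluxIII, intervalIntegral.integral_of_le hx.le, intervalIntegral.integral_of_le hx.le,
    ← integral_sub (hi.mono_set Ioc_subset_Ioi_self) (hi'.mono_set Ioc_subset_Ioi_self),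
    integral_norm_muIII m hα0]
  refine (norm_integral_le_integral_norm _).trans ?_
  simp only [← mul_sub]
  exact setIntegral_mono_set hs.norm (Eventually.of_forall fun _ => norm_nonneg _)
    (LE.le.eventuallyLE Ioc_subset_Ioi_self)

theorem acLocPos_inv_leadIII (m : ℕ) {α : ℝ} (hα0 : α < 0) :
    ACLocPos fun x => ((leadIII m α x)⁻¹ : ℂ) := by
  refine ACLocPos.congr (f := fun x => (((leadIII m α x)⁻¹ : ℝ) : ℂ))
    (acLocPos_of_contDiffOn (Complex.ofRealCLM.contDiff.comp_contDiffOn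
    ((contDiffOn_leadIII m hα0).inv fun x hx => (leadIII_pos m hα0 hx).ne'))) fun x _ => ?_
  push_cast
  rfl

theorem acLocPos_slopeIII (hα0 : α < 0) (hh : Integrable h (muIII m α)) :
    ACLocPos (slopeIII m α h) :=
  (acLocPos_fluxIII hα0 hh).mul (acLocPos_inv_leadIII m hα0)

theorem intervalIntegrable_of_continuousOn_pos {k : ℝ → ℂ} (hk : ContinuousOn k (Ioi 0)) {a b : ℝ}
    (ha : 0 < a) (hb : 0 < b) : IntervalIntegrable k volume a b :=
  (hk.mono fun _ hx => (lt_min ha hb).trans_le hx.1).intervalIntegrable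

theorem hasDerivAt_integral_of_continuousOn_pos {k : ℝ → ℂ} (hk : ContinuousOn k (Ioi 0)) {x : ℝ}
    (hx : 0 < x) : HasDerivAt (fun y => ∫ t in (1 : ℝ)..y, k t) (k x) x :=
  intervalIntegral.integral_hasDerivAt_right (intervalIntegrable_of_continuousOn_pos hk one_pos hx)
    (hk.stronglyMeasurableAtFilter isOpen_Ioi x hx) (hk.continuousAt (Ioi_mem_nhds hx))

/-- In integrating the divergence form from 0, the integration constant is the limit of p f' at 0,
which the boundary condition makes zero. -/
theorem MaxDom.deriv_eq_neg_slopeIII (hα : -1 < α) (hα0 : α < 0) {f : ℝ → ℂ}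
    (hf : MaxDom m α f) (hb : BoundaryCond α f) {x : ℝ} (hx : 0 < x) :
    deriv f x = -slopeIII m α (fun t => ellIII m α f t - ((-(m : ℝ) + α : ℝ) : ℂ) * f t) x := by
  obtain ⟨A, -, h1, -, -, h2⟩ := (hf.acLocPos_quasiDeriv hα0).exists_tendsto
    (hf.integrable_quasiDeriv_deriv hα hα0) (hf.hasDerivAt_quasiDeriv hα0)
  have hA : A = 0 := tendsto_nhds_unique h1 ((boundaryCond_iff m hα0 f).1 hb)
  have h3 := h2 x hx
  have hp : (leadIII m α x : ℂ) ≠ 0 := by exact_mod_cast (leadIII_pos m hα0 hx).ne'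
  simp only [hA, zero_add, neg_mul, intervalIntegral.integral_neg] at h3
  rw [slopeIII, fluxIII, ← neg_div, eq_div_iff hp, mul_comm, h3]

theorem MaxDom.sub_eq_integral_slopeIII (hα : -1 < α) (hα0 : α < 0) {f : ℝ → ℂ}
    (hf : MaxDom m α f) (hb : BoundaryCond α f)
    (hh : h =ᵐ[muIII m α] fun t => ellIII m α f t - ((-(m : ℝ) + α : ℝ) : ℂ) * f t)
    {x : ℝ} (hx : 0 < x) : f x - f 1 = -∫ t in (1 : ℝ)..x, slopeIII m α h t := by
  have hpos : ∀ t ∈ uIcc 1 x, 0 < t := fun t ht => (lt_min one_pos hx).trans_le ht.1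
  rw [← intervalIntegral.integral_eq_sub_of_hasDerivAt (f := f) (f' := deriv f)
    (fun t ht => (hf.diff t (hpos t ht)).hasDerivAt)
    (intervalIntegrable_of_continuousOn_pos hf.acDeriv.continuousOn one_pos hx),
    ← intervalIntegral.integral_neg]
  refine intervalIntegral.integral_congr fun t ht => ?_
  rw [hf.deriv_eq_neg_slopeIII hα hα0 hb (hpos t ht), slopeIII, slopeIII,
    fluxIII_congr hh (hpos t ht)]

/-- Conversely, p y' = -∫_0^x W h differentiates almost everywhere to -W h, which is the divergence
form of the claim. -/
theorem ellIII_of_hasDerivAt_slopeIII (hα0 : α < 0) (hh : Integrable h (muIII m α)) {y : ℝ → ℂ}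
    (hy : ∀ x, 0 < x → HasDerivAt y (-slopeIII m α h x) x) :
    ellIII m α y =ᵐ[muIII m α] fun x => h x + ((-(m : ℝ) + α : ℝ) : ℂ) * y x := by
  rw [EventuallyEq, ae_muIII_iff]
  filter_upwards [hasDerivAt_fluxIII hα0 hh, ae_restrict_mem measurableSet_Ioi] with x h1 hx
  have hx' : (0 : ℝ) < x := hx
  have hp : (leadIII m α x : ℂ) ≠ 0 := by exact_mod_cast (leadIII_pos m hα0 hx').ne'
  have hw : (weightIII m α x : ℂ) ≠ 0 := by exact_mod_cast (weightIII_pos m hα0 hx').ne'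
  have hxc : (x : ℂ) ≠ 0 := by exact_mod_cast hx'.ne'
  have h2 : HasDerivAt (fun t => -slopeIII m α h t) _ x :=
    (h1.div (hasDerivAt_leadIII m hα0 hx').ofReal_comp hp).neg
  have h3 : deriv (deriv y) x = _ :=
    (h2.congr_of_eventuallyEq (by
      filter_upwards [Ioi_mem_nhds hx'] with t ht using (hy t ht).deriv)).deriv
  rw [ellIII, h3, (hy x hx').deriv, slopeIII]
  rw [leadIII_eq m α hx']
  push_cast
  generalize (((derivative (etaIII m α)).eval x : ℝ) : ℂ) / (((etaIII m α).eval x : ℝ) : ℂ) = r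
  field_simp
  ring

/-- The boundary condition comes for free: p y' is minus the flux, which tends to 0 at 0. -/
theorem maxDom_of_hasDerivAt_slopeIII (hα0 : α < 0) (hh : MemLp h 2 (muIII m α))
    (hh1 : Integrable h (muIII m α)) {y : ℝ → ℂ} (hy2 : MemLp y 2 (muIII m α))
    (hy : ∀ x, 0 < x → HasDerivAt y (-slopeIII m α h x) x) :
    MaxDom m α y ∧ BoundaryCond α y := by
  have hk : ACLocPos fun x => -slopeIII m α h x := fun a b ha hab =>
    (acLocPos_slopeIII hα0 hh1 a b ha hab).neg
  have hd : ACLocPos (deriv y) := hk.congr fun x hx => (hy x hx).deriv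
  refine ⟨⟨acLocPos_of_contDiffOn ?_, fun x hx => (hy x hx).differentiableAt, hd, hy2, ?_⟩, ?_⟩
  · refine (contDiffOn_succ_iff_deriv_of_isOpen (n := 0) isOpen_Ioi).2
      ⟨fun x hx => (hy x hx).differentiableAt.differentiableWithinAt, by simp, ?_⟩
    exact contDiffOn_zero.2 hd.continuousOn
  · exact (memLp_congr_ae (ellIII_of_hasDerivAt_slopeIII hα0 hh1 hy)).2
      (hh.add (hy2.const_mul _))
  · rw [boundaryCond_iff m hα0]
    have := (tendsto_fluxIII_zero hα0 hh1).neg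
    rw [neg_zero] at this
    refine this.congr' ?_
    filter_upwards [self_mem_nhdsWithin] with x hx
    have hp : (leadIII m α x : ℂ) ≠ 0 := by exact_mod_cast (leadIII_pos m hα0 hx).ne'
    rw [(hy x hx).deriv, slopeIII]
    field_simp

end Flux

theorem isClosed_typeIIIOp (m : ℕ) {α : ℝ} (hα : -1 < α) (hα0 : α < 0) :
    (typeIIIOp m α).IsClosed := by
  have hfin := isFiniteMeasure_muIII m hα hα0
  refine IsSeqClosed.isClosed fun w z hw hwz => ?_
  obtain ⟨u, v⟩ := z
  have hu : Tendsto (fun n => (w n).1) atTop (𝓝 u) := (continuous_fst.tendsto _).comp hwz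
  have hv : Tendsto (fun n => (w n).2) atTop (𝓝 v) := (continuous_snd.tendsto _).comp hwz
  choose f hf hb huf hvf using fun n => (mem_graph_typeIIIOp_iff m α (w n).1 (w n).2).1 (hw n)
  set c : ℂ := ((-(m : ℝ) + α : ℝ) : ℂ) with hc
  set H : ℕ → HIII m α := fun n => (w n).2 - c • (w n).1 with hH
  set h : HIII m α := v - c • u with hh
  have hHh : Tendsto H atTop (𝓝 h) := hv.sub (hu.const_smul c)
  have hint : ∀ g : HIII m α, Integrable g (muIII m α) := fun g =>
    (Lp.memLp g).integrable one_le_two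
  have hHf : ∀ n, H n =ᵐ[muIII m α] fun t => ellIII m α (f n) t - c * f n t := by
    intro n
    filter_upwards [Lp.coeFn_sub (w n).2 (c • (w n).1), Lp.coeFn_smul c (w n).1, huf n, hvf n]
      with x h1 h2 h3 h4
    rw [hH]
    dsimp only
    rw [h1, Pi.sub_apply, h2, Pi.smul_apply, h3, h4, smul_eq_mul]
  have hd : Tendsto (fun n => ∫ t, ‖H n t - h t‖ ∂(muIII m α)) atTop (𝓝 0) := by
    obtain ⟨K, hK⟩ := exists_integral_norm_le (μ := muIII m α)
    have h1 : Tendsto (fun n => K * ‖H n - h‖) atTop (𝓝 0) := by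
      simpa using (tendsto_iff_norm_sub_tendsto_zero.1 hHh).const_mul K
    refine squeeze_zero (fun n => integral_nonneg fun _ => norm_nonneg _) (fun n => ?_) h1
    refine le_trans (le_of_eq ?_) (hK (H n - h))
    refine integral_congr_ae ?_
    filter_upwards [Lp.coeFn_sub (H n) h] with x hx
    rw [hx, Pi.sub_apply]
  have hcont : ∀ g : HIII m α, ContinuousOn (slopeIII m α g) (Ioi 0) := fun g =>
    (acLocPos_slopeIII hα0 (hint g)).continuousOn
  -- Between 1 and x the function 1/p is integrable and the fluxes converge uniformly, so the
  -- differences from the value at 1 converge pointwise.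
  have hlim : ∀ x, 0 < x → Tendsto (fun n => f n x - f n 1) atTop
      (𝓝 (-∫ t in (1 : ℝ)..x, slopeIII m α h t)) := by
    intro x hx
    have hpinv : ContinuousOn (fun t => (leadIII m α t)⁻¹) (uIcc 1 x) :=
      (((contDiffOn_leadIII m hα0).inv fun t ht => (leadIII_pos m hα0 ht).ne').continuousOn).mono
        fun t ht => (lt_min one_pos hx).trans_le ht.1
    rw [tendsto_iff_norm_sub_tendsto_zero]
    have h1 : Tendsto (fun n => (∫ t, ‖H n t - h t‖ ∂(muIII m α)) *
        |∫ t in (1 : ℝ)..x, (leadIII m α t)⁻¹|) atTop (𝓝 0) := by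
      simpa using hd.mul_const |∫ t in (1 : ℝ)..x, (leadIII m α t)⁻¹|
    refine squeeze_zero (fun _ => norm_nonneg _) (fun n => ?_) h1
    have hd0 : 0 ≤ ∫ t, ‖H n t - h t‖ ∂(muIII m α) := integral_nonneg fun _ => norm_nonneg _
    rw [(hf n).sub_eq_integral_slopeIII hα hα0 (hb n) (hHf n) hx, neg_sub_neg, norm_sub_rev,
      ← intervalIntegral.integral_sub (intervalIntegrable_of_continuousOn_pos (hcont _) one_pos hx)
      (intervalIntegrable_of_continuousOn_pos (hcont _) one_pos hx)]
    refine (intervalIntegral.norm_integral_le_abs_of_norm_le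
      (g := fun t => (∫ t, ‖H n t - h t‖ ∂(muIII m α)) * (leadIII m α t)⁻¹) ?_
      (hpinv.intervalIntegrable.const_mul _)).trans
      (by rw [intervalIntegral.integral_const_mul, abs_mul, abs_of_nonneg hd0])
    filter_upwards [ae_restrict_mem measurableSet_uIoc] with t ht
    have ht0 : 0 < t := (lt_min one_pos hx).trans ht.1
    rw [slopeIII, slopeIII, ← sub_div, norm_div, Complex.norm_real,
      Real.norm_of_nonneg (leadIII_pos m hα0 ht0).le, div_eq_mul_inv]
    exact mul_le_mul_of_nonneg_right (norm_fluxIII_sub_le hα0 (hint _) (hint _) ht0)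
      (inv_nonneg.2 (leadIII_pos m hα0 ht0).le)
  obtain ⟨ns, hns, hae⟩ := (tendstoInMeasure_of_tendsto_Lp hu).exists_seq_tendsto_ae
  have hae' : ∀ᵐ x ∂(muIII m α), 0 < x ∧ Tendsto (fun i => f (ns i) x) atTop (𝓝 (u x)) := by
    filter_upwards [hae, ae_muIII_pos m α, ae_all_iff.2 huf] with x h1 h2 h3
    exact ⟨h2, h1.congr fun i => h3 (ns i)⟩
  -- Almost everywhere convergence of a subsequence forces convergence of the values at 1. Their
  -- limit does not involve x, so u plus the integral of the slope is almost everywhere one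
  -- constant.
  have hone : ∀ᵐ x ∂(muIII m α), Tendsto (fun i => f (ns i) 1) atTop
      (𝓝 (u x + ∫ t in (1 : ℝ)..x, slopeIII m α h t)) := by
    filter_upwards [hae'] with x hx
    have := hx.2.sub ((hlim x hx.1).comp hns.tendsto_atTop)
    simpa [Function.comp_def] using this
  -- The measure is nonzero, so a point x₀ at which the constant can be read off exists.
  have hne : NeBot (ae (muIII m α)) := by
    refine ⟨fun hbot => ?_⟩
    have h1 : ∀ᵐ x ∂(muIII m α), False := by rw [hbot]; exact mem_bot
    rw [ae_muIII_iff, ae_restrict_iff' measurableSet_Ioi, ae_iff] at h1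
    have h2 : volume {x : ℝ | 0 < x} = 0 := by simpa using h1
    exact ENNReal.top_ne_zero ((Real.volume_Ioi (a := 0)).symm.trans h2)
  obtain ⟨x₀, hx₀⟩ := hone.exists
  set y : ℝ → ℂ := fun x =>
    (u x₀ + ∫ t in (1 : ℝ)..x₀, slopeIII m α h t) - ∫ t in (1 : ℝ)..x, slopeIII m α h t with hy
  have huy : u =ᵐ[muIII m α] y := by
    filter_upwards [hone] with x hx
    rw [hy]
    dsimp only
    rw [tendsto_nhds_unique hx₀ hx]
    ring
  have hyd : ∀ x, 0 < x → HasDerivAt y (-slopeIII m α h x) x := fun x hx =>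
    (hasDerivAt_integral_of_continuousOn_pos (hcont h) hx).const_sub _
  have hy2 : MemLp y 2 (muIII m α) := (memLp_congr_ae huy).1 (Lp.memLp u)
  obtain ⟨hmax, hbc⟩ := maxDom_of_hasDerivAt_slopeIII hα0 (Lp.memLp h) (hint h) hy2 hyd
  refine (mem_graph_typeIIIOp_iff m α u v).2 ⟨y, hmax, hbc, huy, ?_⟩
  filter_upwards [ellIII_of_hasDerivAt_slopeIII hα0 (hint h) hyd, huy, Lp.coeFn_sub v (c • u),
    Lp.coeFn_smul c u] with x h1 h2 h3 h4
  rw [h1, ← h2, hh, h3, Pi.sub_apply, h4, Pi.smul_apply, smul_eq_mul]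
  ring

/-! ### The Type III polynomials as a complete orthogonal system of eigenfunctions -/

theorem inner_toLp_polyFun {m : ℕ} {α : ℝ} {q : ℝ[X]} (hq : MemLp (polyFun q) 2 (muIII m α))
    (u : HIII m α) :
    inner ℂ (hq.toLp (polyFun q)) u = ∫ x, polyFun q x * u x ∂(muIII m α) := by
  rw [L2.inner_def]
  refine integral_congr_ae ?_
  filter_upwards [hq.coeFn_toLp] with x hx
  rw [hx, RCLike.inner_apply, polyFun, Complex.conj_ofReal, mul_comm]

theorem typeIIIPoly_ne_zero (m : ℕ) {α : ℝ} {n : ℕ} (hn : n ∈ typeIIIIndex m) :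
    typeIIIPoly m α n ≠ 0 := by
  rcases hn with rfl | hn
  · rw [typeIIIPoly_zero]
    exact one_ne_zero
  · obtain ⟨k, rfl⟩ : ∃ k, n = k + m + 1 := ⟨n - m - 1, by omega⟩
    intro h0
    have h1 := derivative_neg_opA_laguerrePoly m α k
    rw [← typeIIIPoly_add, h0, derivative_zero] at h1
    have h2 : laguerrePoly k (α + 1) ≠ 0 := by
      intro h
      have := degree_laguerrePoly k (α + 1)
      rw [h, degree_zero] at this
      exact absurd this (by simp)
    have h3 : (C ((k : ℝ) + m + 1) : ℝ[X]) ≠ 0 := C_ne_zero.2 (by positivity)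
    exact mul_ne_zero h3 (mul_ne_zero (etaIII_ne_zero m α) h2) h1.symm

theorem ellIII_typeIIIPoly (m : ℕ) {α : ℝ} (hα0 : α < 0) {n : ℕ} (hn : n ∈ typeIIIIndex m) {x : ℝ}
    (hx : 0 < x) : ellIII m α (polyFun (typeIIIPoly m α n)) x =
      (((n : ℝ) - m + α : ℝ) : ℂ) * polyFun (typeIIIPoly m α n) x := by
  have h := congrArg (fun q : ℝ[X] => q.eval x) (typeIIIPoly_eigen m α hn)
  simp only [eval_add, eval_neg, eval_mul, eval_sub, eval_X, eval_C] at h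
  have hη := (etaIII_eval_pos m hα0 hx.le).ne'
  simp only [ellIII, deriv_polyFun, polyFun]
  simp only [← Complex.ofReal_mul, ← Complex.ofReal_neg, ← Complex.ofReal_add]
  rw [Complex.ofReal_inj]
  field_simp
  linear_combination h

/-- The square in η² x^k makes its derivative divisible by η, so these products lie in the span.
Hence all moments of η² u vanish, and η² has no zero on the half-line. -/
theorem ae_eq_zero_of_integral_typeIIIPoly (m : ℕ) {α : ℝ} (hα : -1 < α) (hα0 : α < 0) {u : ℝ → ℂ}
    (hu : MemLp u 2 (muIII m α))
    (h : ∀ n ∈ typeIIIIndex m, ∫ x, polyFun (typeIIIPoly m α n) x * u x ∂(muIII m α) = 0) :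
    u =ᵐ[muIII m α] 0 := by
  have hint : ∀ q : ℝ[X], Integrable (fun x => polyFun q x * u x) (muIII m α) := fun q =>
    (memLp_polyFun m hα hα0 q).integrable_mul hu
  have hspan : ∀ q ∈ Submodule.span ℝ (Set.range fun n : typeIIIIndex m => typeIIIPoly m α n),
      ∫ x, polyFun q x * u x ∂(muIII m α) = 0 := by
    intro q hq
    induction hq using Submodule.span_induction with
    | mem q hq =>
      obtain ⟨n, rfl⟩ := hq
      exact h n n.2
    | zero => simp [polyFun]
    | add p q _ _ hp hq =>
      have e : ∀ x, polyFun (p + q) x * u x = polyFun p x * u x + polyFun q x * u x := fun x => by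
        simp only [polyFun, eval_add]
        push_cast
        ring
      simp only [e]
      rw [integral_add (hint p) (hint q), hp, hq, add_zero]
    | smul c q _ hq =>
      have e : ∀ x, polyFun (c • q) x * u x = (c : ℂ) * (polyFun q x * u x) := fun x => by
        simp only [polyFun, eval_smul, smul_eq_mul]
        push_cast
        ring
      simp only [e]
      rw [integral_const_mul, hq, mul_zero]
  have hdvd : ∀ k : ℕ, etaIII m α ∣ derivative (etaIII m α ^ 2 * X ^ k) := fun k => by
    rw [derivative_mul, derivative_pow]
    refine dvd_add (Dvd.dvd.mul_right ?_ _) (Dvd.dvd.mul_right (dvd_pow_self _ two_ne_zero) _)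
    simp only [Nat.add_one_sub_one, pow_one]
    exact Dvd.dvd.mul_right (Dvd.intro_left _ rfl) _
  have e : ∀ (k : ℕ) (x : ℝ), polyFun (etaIII m α ^ 2 * X ^ k) x * u x =
      polyFun (etaIII m α ^ 2) x * u x * (x : ℂ) ^ k := fun k x => by
    simp only [polyFun, eval_mul, eval_pow, eval_X]
    push_cast
    ring
  have hzero : (fun x => polyFun (etaIII m α ^ 2) x * u x) =ᵐ[muIII m α] 0 := by
    refine ae_eq_zero_of_complex_moments (h := fun x => polyFun (etaIII m α ^ 2) x * u x)
      ((continuous_polyFun _).aestronglyMeasurable.mul hu.1) (δ := 1 / 4) (by norm_num) ?_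
      (fun k => ?_) fun k => ?_
    · have h1 := (memLp_polyFun_mul_exp m hα hα0 (etaIII m α ^ 2)).integrable_mul hu
      refine (integrable_congr ?_).1 h1
      filter_upwards [ae_muIII_pos m α] with x hx
      rw [Pi.mul_apply, abs_of_pos hx, mul_right_comm]
    · exact (hint (etaIII m α ^ 2 * X ^ k)).congr (Eventually.of_forall (e k))
    · rw [← hspan _ (mem_span_typeIIIPoly m α (hdvd k))]
      exact integral_congr_ae (Eventually.of_forall fun x => (e k x).symm)
  filter_upwards [hzero, ae_muIII_pos m α] with x h1 hx
  have hη : polyFun (etaIII m α ^ 2) x ≠ 0 := by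
    have := etaIII_eval_pos m hα0 hx.le
    simp only [polyFun, eval_pow]
    exact_mod_cast (by positivity)
  exact (mul_eq_zero.1 h1).resolve_left hη

theorem mem_graph_typeIIIPoly (m : ℕ) {α : ℝ} (hα : -1 < α) (hα0 : α < 0) {n : ℕ}
    (hn : n ∈ typeIIIIndex m) :
    ((memLp_polyFun m hα hα0 (typeIIIPoly m α n)).toLp _,
      (((n : ℝ) - m + α : ℝ) : ℂ) • (memLp_polyFun m hα hα0 (typeIIIPoly m α n)).toLp _) ∈
      (typeIIIOp m α).graph := by
  set q := typeIIIPoly m α n with hq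
  have hc := (memLp_polyFun m hα hα0 q).coeFn_toLp
  refine (mem_graph_typeIIIOp_iff m α _ _).2
    ⟨polyFun q, maxDom_polyFun m hα hα0 q, ?_, hc, ?_⟩
  · rw [boundaryCond_iff m hα0, deriv_polyFun]
    have h := (tendsto_leadIII_zero m hα hα0).mul
      (((continuous_polyFun (derivative q)).tendsto 0).mono_left
        (nhdsWithin_le_nhds (s := Ioi (0 : ℝ))))
    rwa [zero_mul] at h
  · filter_upwards [Lp.coeFn_smul (((n : ℝ) - m + α : ℝ) : ℂ)
      ((memLp_polyFun m hα hα0 q).toLp (polyFun q)), hc, ae_muIII_pos m α] with x h1 h2 hx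
    rw [h1, Pi.smul_apply, h2, ellIII_typeIIIPoly m hα0 hn hx, smul_eq_mul]

theorem inner_typeIIIPoly_typeIIIOp (m : ℕ) {α : ℝ} (hα : -1 < α) (hα0 : α < 0) {n : ℕ}
    (hn : n ∈ typeIIIIndex m) {u v : HIII m α} (huv : (u, v) ∈ (typeIIIOp m α).graph) :
    inner ℂ ((memLp_polyFun m hα hα0 (typeIIIPoly m α n)).toLp _) v =
      (((n : ℝ) - m + α : ℝ) : ℂ) *
        inner ℂ ((memLp_polyFun m hα hα0 (typeIIIPoly m α n)).toLp _) u := by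
  obtain ⟨f, hf, hb, hu, hv⟩ := (mem_graph_typeIIIOp_iff m α u v).1 huv
  rw [inner_toLp_polyFun, inner_toLp_polyFun, ← integral_const_mul]
  have h1 : ∫ x, polyFun (typeIIIPoly m α n) x * v x ∂(muIII m α) =
      ∫ x, polyFun (typeIIIPoly m α n) x * ellIII m α f x ∂(muIII m α) :=
    integral_congr_ae (by filter_upwards [hv] with x hx; rw [hx])
  rw [h1, hf.integral_mul_ellIII hα hα0 hb]
  refine integral_congr_ae ?_
  filter_upwards [hu, ae_muIII_pos m α] with x h2 hx
  rw [h2, ellIII_typeIIIPoly m hα0 hn hx]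
  ring

/-- A translate of a set of natural numbers, which is closed in ℝ, and ℝ is closed in ℂ. -/
theorem isClosed_eigenvalues (m : ℕ) (α : ℝ) :
    IsClosed (Set.range fun n : typeIIIIndex m => ((((n : ℕ) : ℝ) - m + α : ℝ) : ℂ)) := by
  have h1 : IsClosed ((fun k : ℕ => (k : ℝ)) '' typeIIIIndex m) :=
    Nat.isClosedEmbedding_coe_real.isClosedMap _ (isClosed_discrete _)
  have h2 := Complex.isometry_ofReal.isClosedEmbedding.isClosedMap _
    ((Homeomorph.addRight (α - m)).isClosedMap _ h1)
  convert h2 using 1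
  ext z
  simp only [mem_range, mem_image, Subtype.exists, exists_exists_and_eq_and]
  constructor
  · rintro ⟨n, hn, rfl⟩
    refine ⟨n, hn, ?_⟩
    simp
    ring
  · rintro ⟨n, hn, rfl⟩
    refine ⟨n, hn, ?_⟩
    simp
    ring

/-! ### Assembly of the orthonormal eigenbasis. -/

theorem mainTheorem1 (m : ℕ) (α : ℝ) (hα : -1 < α) (hα0 : α < 0) :
    Dense ((typeIIIOp m α).domain : Set (HIII m α)) ∧
    IsSelfAdjoint (typeIIIOp m α) ∧
    minOp m α ≤ typeIIIOp m α ∧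
    (∃ φ : typeIIIIndex m → (typeIIIOp m α).domain,
      (∀ n : typeIIIIndex m,
        ((φ n : HIII m α) =ᵐ[muIII m α] typeIIIFun m α n) ∧
        (φ n : HIII m α) ≠ 0 ∧
        typeIIIOp m α (φ n) = ((n : ℂ) - (m : ℂ) + (α : ℂ)) • (φ n : HIII m α)) ∧
      (Submodule.span ℂ (Set.range fun n => (φ n : HIII m α))).topologicalClosure = ⊤) ∧
    pmapSpectrum (typeIIIOp m α) = pmapPointSpectrum (typeIIIOp m α) ∧
    pmapSpectrum (typeIIIOp m α) =
      {z : ℂ | ∃ n ∈ typeIIIIndex m, z = (n : ℂ) - (m : ℂ) + (α : ℂ)} := by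
  set ev : typeIIIIndex m → ℝ := fun n => ((n : ℕ) : ℝ) - m + α with hev
  set ψ : typeIIIIndex m → HIII m α := fun n =>
    (memLp_polyFun m hα hα0 (typeIIIPoly m α n)).toLp _ with hψ
  have hgraph : ∀ n, (ψ n, (ev n : ℂ) • ψ n) ∈ (typeIIIOp m α).graph := fun n =>
    mem_graph_typeIIIPoly m hα hα0 n.2
  have hsymm : ∀ (n : typeIIIIndex m) {u v : HIII m α}, (u, v) ∈ (typeIIIOp m α).graph →
      inner ℂ (ψ n) v = ev n * inner ℂ (ψ n) u := fun n _ _ huv =>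
    inner_typeIIIPoly_typeIIIOp m hα hα0 n.2 huv
  have hψae : ∀ n, ψ n =ᵐ[muIII m α] polyFun (typeIIIPoly m α n) := fun n => MemLp.coeFn_toLp _
  have hψ0 : ∀ n, ψ n ≠ 0 := by
    intro n h0
    have h1 : polyFun (typeIIIPoly m α n) =ᵐ[muIII m α] polyFun 0 := by
      refine (hψae n).symm.trans ?_
      rw [h0]
      filter_upwards [Lp.coeFn_zero ℂ 2 (muIII m α)] with x hx
      rw [hx]
      simp [polyFun]
    have h2 := (maxDom_polyFun m hα hα0 (typeIIIPoly m α n)).eq_pos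
      (maxDom_polyFun m hα hα0 0) h1
    -- A polynomial whose class is zero vanishes on all of (0,∞), hence is zero.
    refine typeIIIPoly_ne_zero m (α := α) n.2 (eq_of_infinite_eval_eq _ _ ((Ioi_infinite (0 : ℝ)).mono ?_))
    intro x hx
    exact Complex.ofReal_injective (h2 x hx)
  -- Orthogonality comes from symmetry and distinct eigenvalues, without computing any integral.
  have horth : ∀ i j, i ≠ j → inner ℂ (ψ i) (ψ j) = 0 := by
    intro i j hij
    have h1 := hsymm i (hgraph j)
    rw [inner_smul_right] at h1
    have h2 : (ev j : ℂ) ≠ ev i := by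
      intro h
      have h3 : ev j = ev i := Complex.ofReal_injective h
      have h4 : ((j : ℕ) : ℝ) = (i : ℕ) := by simpa [hev] using h3
      exact hij (Subtype.ext (Nat.cast_injective h4).symm)
    by_contra hne
    exact h2 (mul_right_cancel₀ hne h1)
  have hperp : (Submodule.span ℂ (Set.range ψ))ᗮ = ⊥ := by
    rw [Submodule.eq_bot_iff]
    intro u hu
    have h1 := ae_eq_zero_of_integral_typeIIIPoly m hα hα0 (Lp.memLp u) fun n hn => by
      rw [← inner_toLp_polyFun (memLp_polyFun m hα hα0 (typeIIIPoly m α n))]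
      exact (Submodule.mem_orthogonal _ _).1 hu _ (Submodule.subset_span ⟨⟨n, hn⟩, rfl⟩)
    exact Lp.ext (h1.trans (Lp.coeFn_zero ℂ 2 (muIII m α)).symm)
  set e : typeIIIIndex m → HIII m α := fun n => ((‖ψ n‖⁻¹ : ℝ) : ℂ) • ψ n with he
  have hn0 : ∀ n, ((‖ψ n‖⁻¹ : ℝ) : ℂ) ≠ 0 := fun n => by
    exact_mod_cast inv_ne_zero (norm_ne_zero_iff.2 (hψ0 n))
  have hon : Orthonormal ℂ e := by
    refine ⟨fun n => ?_, fun i j hij => ?_⟩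
    · rw [he]
      dsimp only
      rw [norm_smul, Complex.norm_real, norm_inv, norm_norm,
        inv_mul_cancel₀ (norm_ne_zero_iff.2 (hψ0 n))]
    · rw [he]
      dsimp only
      rw [inner_smul_left, inner_smul_right, horth i j hij, mul_zero, mul_zero]
  have hspan : Submodule.span ℂ (Set.range ψ) ≤ Submodule.span ℂ (Set.range e) := by
    rw [Submodule.span_le]
    rintro _ ⟨n, rfl⟩
    have h1 : ψ n = ((‖ψ n‖⁻¹ : ℝ) : ℂ)⁻¹ • e n := by
      rw [he, inv_smul_smul₀ (hn0 n)]
    rw [h1]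
    exact Submodule.smul_mem _ _ (Submodule.subset_span ⟨n, rfl⟩)
  have hperp' : (Submodule.span ℂ (Set.range e))ᗮ = ⊥ :=
    le_bot_iff.1 ((Submodule.orthogonal_le hspan).trans hperp.le)
  set b := HilbertBasis.mkOfOrthogonalEqBot hon hperp' with hb
  have hbe : ∀ n, b n = e n := fun n => by
    rw [hb, HilbertBasis.coe_mkOfOrthogonalEqBot]
  have hbg : ∀ n, (b n, (ev n : ℂ) • b n) ∈ (typeIIIOp m α).graph := fun n => by
    have := (typeIIIOp m α).graph.smul_mem ((‖ψ n‖⁻¹ : ℝ) : ℂ) (hgraph n)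
    rw [hbe n]
    rwa [Prod.smul_mk, smul_comm] at this
  have hbs : ∀ (x : (typeIIIOp m α).domain) (n : typeIIIIndex m),
      inner ℂ (b n) (typeIIIOp m α x) = ev n * inner ℂ (b n) (x : HIII m α) := fun x n => by
    rw [hbe, he]
    dsimp only
    rw [inner_smul_left, inner_smul_left, hsymm n ((typeIIIOp m α).mem_graph x)]
    ring
  have hcl := isClosed_typeIIIOp m hα hα0
  have hspec := pmapSpectrum_of_eigenbasis b hcl hbg hbs (isClosed_eigenvalues m α)
  refine ⟨dense_domain_of_eigenbasis b hbg, isSelfAdjoint_of_eigenbasis b hcl hbg hbs,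
    minOp_le_typeIIIOp m hα hα0,
    ⟨fun n => ⟨ψ n, LinearPMap.mem_domain_of_mem_graph (hgraph n)⟩,
      fun n => ⟨hψae n, hψ0 n, ?_⟩, ?_⟩, ?_, ?_⟩
  · rw [LinearPMap.mem_graph_snd_inj _ ((typeIIIOp m α).mem_graph _) (hgraph n) rfl]
    simp [hev]
  · exact Submodule.topologicalClosure_eq_top_iff.2 hperp
  · rw [hspec, pmapPointSpectrum_of_eigenbasis b hbg hbs]
  · rw [hspec]
    ext z
    simp only [hev, mem_range, Subtype.exists, mem_ofPred_eq]
    constructor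
    · rintro ⟨n, hn, rfl⟩
      exact ⟨n, hn, by push_cast; rfl⟩
    · rintro ⟨n, hn, rfl⟩
      exact ⟨n, hn, by push_cast; rfl⟩
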